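/- Let $n\ge 1$ be an integer, let $F\subset\mathbb R^n$ be non-empty and bounded, and let $\theta\in(0,1]$. Write $|x|$ for the Euclidean norm of $x\in\mathbb R^n$ and $|U|$ for the diameter of $U\subset\mathbb R^n$. For $\delta>0$, call a finite or countable collection $\{U_i\}$ of subsets of $\mathbb R^n$ a $\delta$-admissible cover of $F$ if $F\subset\bigcup_i U_i$ and $\delta^{1/\theta}\le |U_i|\le\delta$ for all $i$. The lower and upper $\theta$-intermediate dimensions of $F$ are $$\underline{\dim}_\theta F=\inf\Big\{s\ge 0:\ \forall \epsilon>0\ \forall\delta_0>0\ \exists\, 0<\delta\le\delta_0 \text{ and a $\delta$-admissible cover } \{U_i\} \text{ of } F \text{ with } \sum_i|U_i|^s\le\epsilon\Big\},$$ $$\overline{\dim}_\theta F=\inf\Big\{s\ge 0:\ \forall \epsilon>0\ \exists\delta_0>0\ \forall\, 0<\delta\le\delta_0 \text{ there is a $\delta$-admissible cover } \{U_i\} \text{ of } F \text{ with } \sum_i|U_i|^s\le\epsilon\Big\}.$$ For $0<r<1$, real $0<m\le n$ and $0\le s\le m$ let $$\phi^{s,m}_{r,\theta}(x)=\begin{cases}1,&0\le|x|<r,\\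 (r/|x|)^s,& r\le|x|<r^\theta,\\ r^{\theta(m-s)+s}/|x|^m,& r^\theta\le|x|,\end{cases}\qquad x\in\mathbb R^n,$$ and let the capacity of $F$ be $$C^{s,m}_{r,\theta}(F)=\Big(\inf_\mu\iint\phi^{s,m}_{r,\theta}(x-y)\,d\mu(x)\,d\mu(y)\Big)^{-1},$$ where the infimum is over all Borel probability measures $\mu$ supported on the closure $\overline F$. Then there is exactly one $s\in[0,n]$ with $$\liminf_{r\to0^+}\frac{\log C^{s,n}_{r,\theta}(F)}{-\log r}=s,$$ denoted $\underline{\dim}^{\,n}_\theta F$, and exactly one $s\in[0,n]$ with $$\limsup_{r\to0^+}\frac{\log C^{s,n}_{r,\theta}(F)}{-\log r}=s,$$ denoted $\overline{\dim}^{\,n}_\theta F$ (the lower and upper $\theta$-intermediate dimension profiles of $F$ with $m=n$), and $$\underline{\dim}_\theta F=\underline{\dim}^{\,n}_\theta F,\qquad \overline{\dim}_\theta F=\overline{\dim}^{\,n}_\theta F.$$ -/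

import Mathlib

open MeasureTheory Filter Topology
open scoped ENNReal

noncomputable section

namespace IntermediateDim

/-! ### Intermediate dimensions through covers -/

/-- `𝒰` is a finite or countable cover of `F` by sets `U` whose diameters satisfy
`δ ^ (1 / θ) ≤ |U| ≤ δ` (used for `0 < θ ≤ 1` and `0 < δ`). Diameters are extended, so that
unbounded sets have diameter `∞` and are not admissible. -/
def IsAdmissibleCover {n : ℕ} (θ δ : ℝ) (F : Set (EuclideanSpace ℝ (Fin n)))
    (𝒰 : Set (Set (EuclideanSpace ℝ (Fin n)))) : Prop :=
  𝒰.Countable ∧ F ⊆ ⋃₀ 𝒰 ∧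
    ∀ U ∈ 𝒰, ENNReal.ofReal (δ ^ (1 / θ)) ≤ Metric.ediam U ∧ Metric.ediam U ≤ ENNReal.ofReal δ

/-- There is an admissible cover of `F` at scale `δ` with `∑ |U| ^ s ≤ ε`. -/
def HasCoverWithSum {n : ℕ} (θ δ s ε : ℝ) (F : Set (EuclideanSpace ℝ (Fin n))) : Prop :=
  ∃ 𝒰 : Set (Set (EuclideanSpace ℝ (Fin n))),
    IsAdmissibleCover θ δ F 𝒰 ∧ ∑' U : 𝒰, Metric.ediam U.1 ^ s ≤ ENNReal.ofReal ε

/-- The lower `θ`-intermediate dimension of `F`, for `0 < θ ≤ 1`. The infimum is taken in the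
extended reals, so that an infimum over no exponents would be `⊤`. -/
def lowerDim {n : ℕ} (θ : ℝ) (F : Set (EuclideanSpace ℝ (Fin n))) : EReal :=
  sInf ((fun s : ℝ => (s : EReal)) ''
    {s : ℝ | 0 ≤ s ∧ ∀ ε : ℝ, 0 < ε → ∀ δ₀ : ℝ, 0 < δ₀ →
      ∃ δ : ℝ, 0 < δ ∧ δ ≤ δ₀ ∧ HasCoverWithSum θ δ s ε F})

/-- The upper `θ`-intermediate dimension of `F`, for `0 < θ ≤ 1`. -/
def upperDim {n : ℕ} (θ : ℝ) (F : Set (EuclideanSpace ℝ (Fin n))) : EReal :=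
  sInf ((fun s : ℝ => (s : EReal)) ''
    {s : ℝ | 0 ≤ s ∧ ∀ ε : ℝ, 0 < ε → ∃ δ₀ : ℝ, 0 < δ₀ ∧
      ∀ δ : ℝ, 0 < δ → δ ≤ δ₀ → HasCoverWithSum θ δ s ε F})

/-! ### Kernels, energies, capacities, and dimension profiles -/

/-- The kernel `φ^{s,m}_{r,θ}` on `ℝⁿ`. -/
def kernel {n : ℕ} (r θ s m : ℝ) (x : EuclideanSpace ℝ (Fin n)) : ℝ :=
  if ‖x‖ < r then 1
  else if ‖x‖ < r ^ θ then (r / ‖x‖) ^ s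
  else r ^ (θ * (m - s) + s) / ‖x‖ ^ m

/-- The energy of a Borel probability measure with respect to `φ^{s,m}_{r,θ}`. -/
def energy {n : ℕ} (r θ s m : ℝ) (μ : ProbabilityMeasure (EuclideanSpace ℝ (Fin n))) : ℝ :=
  ∫ y, ∫ x, kernel r θ s m (x - y) ∂(μ : Measure (EuclideanSpace ℝ (Fin n)))
    ∂(μ : Measure (EuclideanSpace ℝ (Fin n)))

/-- The Borel probability measures supported on the closed set `K`. -/
def measuresOn {n : ℕ} (K : Set (EuclideanSpace ℝ (Fin n))) :
    Set (ProbabilityMeasure (EuclideanSpace ℝ (Fin n))) :=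
  {μ | (μ : Measure (EuclideanSpace ℝ (Fin n))) Kᶜ = 0}

/-- The capacity `C^{s,m}_{r,θ}(F)` of a bounded set `F`: the reciprocal of the infimum of the
energies of the Borel probability measures supported on the closure of `F`. -/
def capacity {n : ℕ} (r θ s m : ℝ) (F : Set (EuclideanSpace ℝ (Fin n))) : ℝ :=
  (sInf (energy r θ s m '' measuresOn (closure F)))⁻¹

/-- The quotient `log C^{s,m}_{r,θ}(F) / (- log r)`. -/
def logCapacityRatio {n : ℕ} (r θ s m : ℝ) (F : Set (EuclideanSpace ℝ (Fin n))) : ℝ :=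
  Real.log (capacity r θ s m F) / (-Real.log r)

/-- `s ∈ [0, m]` satisfies the equation defining the lower `θ`-intermediate dimension profile:
`liminf_{r → 0+} log C^{s,m}_{r,θ}(F) / (- log r) = s`, the lower limit taken in the extended
reals. -/
def SolvesLowerProfile {n : ℕ} (θ m : ℝ) (F : Set (EuclideanSpace ℝ (Fin n))) (s : ℝ) : Prop :=
  s ∈ Set.Icc 0 m ∧
    liminf (fun r : ℝ => (logCapacityRatio r θ s m F : EReal)) (𝓝[>] 0) = (s : EReal)

/-- `s ∈ [0, m]` satisfies the equation defining the upper `θ`-intermediate dimension profile: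
`limsup_{r → 0+} log C^{s,m}_{r,θ}(F) / (- log r) = s`. -/
def SolvesUpperProfile {n : ℕ} (θ m : ℝ) (F : Set (EuclideanSpace ℝ (Fin n))) (s : ℝ) : Prop :=
  s ∈ Set.Icc 0 m ∧
    limsup (fun r : ℝ => (logCapacityRatio r θ s m F : EReal)) (𝓝[>] 0) = (s : EReal)

/-- The lower `θ`-intermediate dimension profile: the (unique) `s ∈ [0, m]` that solves its
defining equation. -/
def lowerProfile {n : ℕ} (θ m : ℝ) (F : Set (EuclideanSpace ℝ (Fin n))) : ℝ :=
  Classical.epsilon (SolvesLowerProfile θ m F)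

/-- The upper `θ`-intermediate dimension profile: the (unique) `s ∈ [0, m]` that solves its
defining equation. -/
def upperProfile {n : ℕ} (θ m : ℝ) (F : Set (EuclideanSpace ℝ (Fin n))) : ℝ :=
  Classical.epsilon (SolvesUpperProfile θ m F)

end IntermediateDim

end

noncomputable section

namespace IntermediateDim

/-! Let `L s` be the lower (or upper) limit of log capacity over -log r. Raising the exponent from t
to s multiplies the kernel by a factor between r^((1-θ)(s-t)) and 1, so `L` is nondecreasing with
Lipschitz constant 1-θ < 1. Hence `L s - s` is strictly decreasing: it has exactly one zero a, and a
is the least s with `L s ≤ s` (`exists_isFixed_and_unique`). It remains to show that covers at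
exponent s force `L s ≤ s`, and that `L a = a` produces covers at every s > a.

From covers to energy: with r = δ^(1/θ) the admissible diameters are those in [r, r^θ], where the
kernel is (r/|x|)^s. Make the cover disjoint and keep only pairs of points in a common piece;
Cauchy–Schwarz then bounds the energy of every measure below by r^s / ∑|U|^s
(`rpow_div_sum_rpow_le_energy`).

From energy to covers: minimise the energy over weights on a finite r-net of F. By the first
variation, the potential at every net point is at least the minimal energy γ. Splitting the
potential over dyadic scales and pigeonholing yields, around each net point, a ball of some radius ρ
with mass at least γ/φ(ρ), up to a logarithmic factor. Vitali selects disjoint balls, of total mass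
at most 1. Each enlarged ball is cut into about (ρ/d)^n balls of diameter d = min(ρ, r^θ), which at
exponent t costs r^t/φ(ρ), precisely because m = n. The total is at most a constant times log(1/r)
r^t/γ (`hasCoverWithSum_of_minEnergy`), and passing to s > t gains a power of r that beats the
logarithm. -/

/-- The radial profile of the kernel: `kernel r θ s m x = radialProfile r θ s m (max ‖x‖ r)`. -/
def radialProfile (r θ s m ρ : ℝ) : ℝ := (r / ρ) ^ s * (min 1 (r ^ θ / ρ)) ^ (m - s)

/-! ### Radial profile: monotonicity, doubling, dependence on the exponent. -/

section Profile

variable {r θ s t m ρ ρ' : ℝ}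

lemma min_one_rpow_div_pos (hr : 0 < r) (hρ : 0 < ρ) : 0 < min 1 (r ^ θ / ρ) :=
  lt_min one_pos (by positivity)

lemma radialProfile_pos (hr : 0 < r) (hρ : 0 < ρ) : 0 < radialProfile r θ s m ρ :=
  mul_pos (by positivity) (Real.rpow_pos_of_pos (min_one_rpow_div_pos hr hρ) _)

lemma le_rpow_self_of_le_one (hr : 0 < r) (hr1 : r ≤ 1) (hθ : θ ≤ 1) : r ≤ r ^ θ := by
  simpa using Real.rpow_le_rpow_of_exponent_ge hr hr1 hθ

lemma kernel_eq_radialProfile {n : ℕ} (hr : 0 < r) (hr1 : r ≤ 1) (hθ : θ ≤ 1)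
    (x : EuclideanSpace ℝ (Fin n)) :
    kernel r θ s m x = radialProfile r θ s m (max ‖x‖ r) := by
  have hR : 0 < r ^ θ := by positivity
  have hrR := le_rpow_self_of_le_one hr hr1 hθ
  unfold kernel radialProfile
  split_ifs with h1 h2
  · rw [max_eq_right h1.le, min_eq_left ((one_le_div hr).2 hrR)]
    simp [hr.ne']
  · push Not at h1
    rw [max_eq_left h1, min_eq_left ((one_le_div (hr.trans_le h1)).2 h2.le)]
    simp
  · push Not at h1 h2
    have hx : 0 < ‖x‖ := hr.trans_le h1
    rw [max_eq_left h1, min_eq_right ((div_le_one hx).2 h2), Real.div_rpow hr.le hx.le,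
      Real.div_rpow hR.le hx.le, div_mul_div_comm, ← Real.rpow_mul hr.le, ← Real.rpow_add hx,
      ← Real.rpow_add hr]
    congr 2 <;> ring

lemma radialProfile_anti (hr : 0 < r) (hs : 0 ≤ s) (hsm : s ≤ m) (hρ : 0 < ρ) (h : ρ ≤ ρ') :
    radialProfile r θ s m ρ' ≤ radialProfile r θ s m ρ := by
  have hρ' := hρ.trans_le h
  have hR : 0 < r ^ θ := by positivity
  have h0 := min_one_rpow_div_pos (θ := θ) hr hρ'
  have hms : 0 ≤ m - s := sub_nonneg.2 hsm
  unfold radialProfile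
  gcongr

lemma radialProfile_le_one (hr : 0 < r) (hs : 0 ≤ s) (hsm : s ≤ m) (hρ : r ≤ ρ) :
    radialProfile r θ s m ρ ≤ 1 := by
  have hρ0 := hr.trans_le hρ
  refine mul_le_one₀ (Real.rpow_le_one (by positivity) ((div_le_one hρ0).2 hρ) hs)
    (Real.rpow_nonneg (min_one_rpow_div_pos hr hρ0).le _)
    (Real.rpow_le_one (min_one_rpow_div_pos hr hρ0).le (min_le_left _ _) (sub_nonneg.2 hsm))

/-- Halving the radius at most doubles each of the two bases, and the exponents s and m - s add up
to m. -/
lemma radialProfile_doubling (hr : 0 < r) (hsm : s ≤ m) (hρ : 0 < ρ) :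
    radialProfile r θ s m ρ ≤ 2 ^ m * radialProfile r θ s m (2 * ρ) := by
  have hR : 0 < r ^ θ := by positivity
  have h1 : r / ρ = 2 * (r / (2 * ρ)) := by field_simp
  have h2 : min 1 (r ^ θ / ρ) ≤ 2 * min 1 (r ^ θ / (2 * ρ)) := by
    have : r ^ θ / ρ = 2 * (r ^ θ / (2 * ρ)) := by field_simp
    rw [mul_min_of_nonneg _ _ (by norm_num), ← this]
    exact min_le_min_right _ (by norm_num)
  have h3 := min_one_rpow_div_pos (θ := θ) hr (show 0 < 2 * ρ by positivity)
  have hms : 0 ≤ m - s := sub_nonneg.2 hsm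
  have h4 := min_one_rpow_div_pos (θ := θ) hr hρ
  calc radialProfile r θ s m ρ
      ≤ (2 * (r / (2 * ρ))) ^ s * (2 * min 1 (r ^ θ / (2 * ρ))) ^ (m - s) := by
        unfold radialProfile
        rw [← h1]
        gcongr
    _ = 2 ^ m * radialProfile r θ s m (2 * ρ) := by
        rw [Real.mul_rpow (by norm_num) (by positivity), Real.mul_rpow (by norm_num) h3.le]
        have : (2 : ℝ) ^ m = 2 ^ s * 2 ^ (m - s) := by
          rw [← Real.rpow_add (by norm_num)]; congr 1; ring
        rw [this]
        unfold radialProfile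
        ring

lemma le_radialProfile {D : ℝ} (hr : 0 < r) (hr1 : r ≤ 1) (hθ : θ ≤ 1) (hs : 0 ≤ s) (hsm : s ≤ m)
    (hρ : 0 < ρ) (hD : ρ ≤ D) (hD1 : 1 ≤ D) : (r / D) ^ m ≤ radialProfile r θ s m ρ := by
  have hrR := le_rpow_self_of_le_one hr hr1 hθ
  have hms : 0 ≤ m - s := sub_nonneg.2 hsm
  have hD0 : 0 < D := by linarith
  have h1 : r / D ≤ r / ρ := by gcongr
  have h2 : r / D ≤ min 1 (r ^ θ / ρ) :=
    le_min ((div_le_one hD0).2 (by linarith)) (by gcongr)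
  have : (r / D) ^ m = (r / D) ^ s * (r / D) ^ (m - s) := by
    rw [← Real.rpow_add (by positivity)]; congr 1; ring
  rw [this]
  unfold radialProfile
  gcongr

/-- The base of the correction factor lies between r^(1-θ) and 1 when ρ ≥ r; this one identity gives
both the monotonicity and the Lipschitz bound in the exponent. -/
lemma radialProfile_eq_mul (hr : 0 < r) (hρ : 0 < ρ) :
    radialProfile r θ s m ρ =
      radialProfile r θ t m ρ * ((r / ρ) / min 1 (r ^ θ / ρ)) ^ (s - t) := by
  have h0 := min_one_rpow_div_pos (θ := θ) hr hρ
  have h1 : 0 < r / ρ := by positivity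
  unfold radialProfile
  rw [Real.div_rpow h1.le h0.le, div_eq_mul_inv _ (min 1 (r ^ θ / ρ) ^ (s - t)),
    ← Real.rpow_neg h0.le]
  rw [mul_mul_mul_comm, ← Real.rpow_add h1, ← Real.rpow_add h0]
  congr 2 <;> ring

lemma radialProfile_le_of_le (hr : 0 < r) (hr1 : r ≤ 1) (hθ : θ ≤ 1) (hts : t ≤ s)
    (hρ : r ≤ ρ) : radialProfile r θ s m ρ ≤ radialProfile r θ t m ρ := by
  have hρ0 := hr.trans_le hρ
  have h0 := min_one_rpow_div_pos (θ := θ) hr hρ0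
  have hrR := le_rpow_self_of_le_one hr hr1 hθ
  rw [radialProfile_eq_mul (t := t) hr hρ0]
  refine mul_le_of_le_one_right (radialProfile_pos hr hρ0).le
    (Real.rpow_le_one (by positivity) ((div_le_one h0).2 (le_min ((div_le_one hρ0).2 hρ) ?_))
      (sub_nonneg.2 hts))
  exact div_le_div_of_nonneg_right hrR hρ0.le

lemma rpow_mul_radialProfile_le (hr : 0 < r) (hts : t ≤ s) (hρ : 0 < ρ) :
    r ^ ((1 - θ) * (s - t)) * radialProfile r θ t m ρ ≤ radialProfile r θ s m ρ := by
  have h0 := min_one_rpow_div_pos (θ := θ) hr hρ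
  rw [radialProfile_eq_mul (s := s) (t := t) hr hρ, mul_comm, Real.rpow_mul hr.le]
  have hp := (radialProfile_pos (θ := θ) (s := t) (m := m) hr hρ).le
  have hst : 0 ≤ s - t := sub_nonneg.2 hts
  have : r ^ (1 - θ) ≤ (r / ρ) / min 1 (r ^ θ / ρ) := by
    rw [le_div_iff₀ h0]
    calc r ^ (1 - θ) * min 1 (r ^ θ / ρ) ≤ r ^ (1 - θ) * (r ^ θ / ρ) := by
          gcongr; exact min_le_right _ _
      _ = r / ρ := by
          rw [← mul_div_assoc, ← Real.rpow_add hr]; simp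
  gcongr

/-- Cutting a ball of radius `ρ` into `(ρ / d) ^ m` pieces of diameter `d = min ρ (r ^ θ)` costs the
reciprocal of the radial profile. -/
lemma div_rpow_mul_rpow_eq (hr : 0 < r) (hρ : 0 < ρ) :
    (ρ / min ρ (r ^ θ)) ^ m * (min ρ (r ^ θ)) ^ s = r ^ s / radialProfile r θ s m ρ := by
  have h0 := min_one_rpow_div_pos (θ := θ) hr hρ
  have h1 : min ρ (r ^ θ) = ρ * min 1 (r ^ θ / ρ) := by
    rw [mul_min_of_nonneg _ _ hρ.le, mul_one, mul_div_cancel₀ _ hρ.ne']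
  unfold radialProfile
  rw [h1]
  set q := min 1 (r ^ θ / ρ)
  have h2 : ρ / (ρ * q) = q⁻¹ := by field_simp
  rw [h2, Real.mul_rpow hρ.le h0.le, Real.div_rpow hr.le hρ.le, Real.inv_rpow h0.le,
    Real.rpow_sub h0]
  have := Real.rpow_pos_of_pos h0 s
  have := Real.rpow_pos_of_pos h0 m
  have := Real.rpow_pos_of_pos hr s
  have := Real.rpow_pos_of_pos hρ s
  field_simp

end Profile

/-! ### Bounds, symmetry and measurability of the kernel. -/

section Kernel

variable {n : ℕ} {r θ s t m : ℝ} {x : EuclideanSpace ℝ (Fin n)}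

lemma kernel_nonneg (hr : 0 < r) (hr1 : r ≤ 1) (hθ : θ ≤ 1) : 0 ≤ kernel r θ s m x := by
  rw [kernel_eq_radialProfile hr hr1 hθ]
  exact (radialProfile_pos hr (lt_max_of_lt_right hr)).le

lemma kernel_le_one (hr : 0 < r) (hr1 : r ≤ 1) (hθ : θ ≤ 1) (hs : 0 ≤ s) (hsm : s ≤ m) :
    kernel r θ s m x ≤ 1 := by
  rw [kernel_eq_radialProfile hr hr1 hθ]
  exact radialProfile_le_one hr hs hsm (le_max_right _ _)

lemma kernel_neg (x : EuclideanSpace ℝ (Fin n)) : kernel r θ s m (-x) = kernel r θ s m x := by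
  simp [kernel]

lemma measurable_kernel :
    Measurable (kernel r θ s m : EuclideanSpace ℝ (Fin n) → ℝ) := by
  unfold kernel
  refine Measurable.ite (measurableSet_lt measurable_norm measurable_const) measurable_const
    (Measurable.ite (measurableSet_lt measurable_norm measurable_const) ?_ ?_)
  · fun_prop
  · fun_prop

end Kernel

/-! ### Energies, minimal energy, and the logarithmic capacity ratio. -/

section Energy

variable {n : ℕ} {r θ s t m : ℝ} {F : Set (EuclideanSpace ℝ (Fin n))}
  {μ : ProbabilityMeasure (EuclideanSpace ℝ (Fin n))}

lemma measurable_kernel_sub :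
    Measurable fun z : EuclideanSpace ℝ (Fin n) × EuclideanSpace ℝ (Fin n) =>
      kernel r θ s m (z.1 - z.2) :=
  measurable_kernel.comp (measurable_fst.sub measurable_snd)

lemma integrable_kernel_sub (hr : 0 < r) (hr1 : r ≤ 1) (hθ : θ ≤ 1) (hs : 0 ≤ s) (hsm : s ≤ m)
    (μ : ProbabilityMeasure (EuclideanSpace ℝ (Fin n))) :
    Integrable (fun z : EuclideanSpace ℝ (Fin n) × EuclideanSpace ℝ (Fin n) =>
      kernel r θ s m (z.1 - z.2))
      ((μ : Measure (EuclideanSpace ℝ (Fin n))).prod (μ : Measure (EuclideanSpace ℝ (Fin n)))) := by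
  refine Integrable.of_bound measurable_kernel_sub.aestronglyMeasurable 1 (ae_of_all _ fun z => ?_)
  rw [Real.norm_of_nonneg (kernel_nonneg hr hr1 hθ)]
  exact kernel_le_one hr hr1 hθ hs hsm

lemma energy_eq_integral_prod (hr : 0 < r) (hr1 : r ≤ 1) (hθ : θ ≤ 1) (hs : 0 ≤ s) (hsm : s ≤ m)
    (μ : ProbabilityMeasure (EuclideanSpace ℝ (Fin n))) :
    energy r θ s m μ = ∫ z, kernel r θ s m (z.1 - z.2)
      ∂((μ : Measure (EuclideanSpace ℝ (Fin n))).prod (μ : Measure (EuclideanSpace ℝ (Fin n)))) :=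
  (integral_prod_symm _ (integrable_kernel_sub hr hr1 hθ hs hsm μ)).symm

lemma energy_nonneg (hr : 0 < r) (hr1 : r ≤ 1) (hθ : θ ≤ 1) : 0 ≤ energy r θ s m μ :=
  integral_nonneg fun _ => integral_nonneg fun _ => kernel_nonneg hr hr1 hθ

lemma energy_le_one (hr : 0 < r) (hr1 : r ≤ 1) (hθ : θ ≤ 1) (hs : 0 ≤ s) (hsm : s ≤ m) :
    energy r θ s m μ ≤ 1 := by
  rw [energy_eq_integral_prod hr hr1 hθ hs hsm]
  calc _ ≤ ∫ _, (1 : ℝ) ∂((μ : Measure (EuclideanSpace ℝ (Fin n))).prod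
        (μ : Measure (EuclideanSpace ℝ (Fin n)))) :=
        integral_mono (integrable_kernel_sub hr hr1 hθ hs hsm μ) (integrable_const _)
          fun _ => kernel_le_one hr hr1 hθ hs hsm
    _ = 1 := by simp

lemma energy_le_of_le (hr : 0 < r) (hr1 : r ≤ 1) (hθ : θ ≤ 1) (ht : 0 ≤ t) (hts : t ≤ s)
    (hsm : s ≤ m) : energy r θ s m μ ≤ energy r θ t m μ := by
  rw [energy_eq_integral_prod hr hr1 hθ (ht.trans hts) hsm,
    energy_eq_integral_prod hr hr1 hθ ht (hts.trans hsm)]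
  refine integral_mono (integrable_kernel_sub hr hr1 hθ (ht.trans hts) hsm μ)
    (integrable_kernel_sub hr hr1 hθ ht (hts.trans hsm) μ) fun z => ?_
  simp only [kernel_eq_radialProfile hr hr1 hθ]
  exact radialProfile_le_of_le hr hr1 hθ hts (le_max_right _ _)

lemma rpow_mul_energy_le (hr : 0 < r) (hr1 : r ≤ 1) (hθ : θ ≤ 1) (ht : 0 ≤ t) (hts : t ≤ s)
    (hsm : s ≤ m) :
    r ^ ((1 - θ) * (s - t)) * energy r θ t m μ ≤ energy r θ s m μ := by
  rw [energy_eq_integral_prod hr hr1 hθ (ht.trans hts) hsm,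
    energy_eq_integral_prod hr hr1 hθ ht (hts.trans hsm), ← integral_const_mul]
  refine integral_mono ((integrable_kernel_sub hr hr1 hθ ht (hts.trans hsm) μ).const_mul _)
    (integrable_kernel_sub hr hr1 hθ (ht.trans hts) hsm μ) fun z => ?_
  simp only [kernel_eq_radialProfile hr hr1 hθ]
  exact rpow_mul_radialProfile_le hr hts (lt_max_of_lt_right hr)

lemma ae_mem_prod_of_mem_measuresOn {K : Set (EuclideanSpace ℝ (Fin n))} (hμ : μ ∈ measuresOn K) :
    ∀ᵐ z ∂((μ : Measure (EuclideanSpace ℝ (Fin n))).prod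
      (μ : Measure (EuclideanSpace ℝ (Fin n)))), z.1 ∈ K ∧ z.2 ∈ K := by
  have h : ∀ᵐ x ∂(μ : Measure (EuclideanSpace ℝ (Fin n))), x ∈ K := hμ
  exact (Measure.quasiMeasurePreserving_fst.ae h).and (Measure.quasiMeasurePreserving_snd.ae h)

lemma le_energy {D : ℝ} (hr : 0 < r) (hr1 : r ≤ 1) (hθ : θ ≤ 1) (hs : 0 ≤ s) (hsm : s ≤ m)
    (hD : 1 ≤ D) {K : Set (EuclideanSpace ℝ (Fin n))} (hK : ∀ x ∈ K, ∀ y ∈ K, dist x y ≤ D)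
    (hμ : μ ∈ measuresOn K) : (r / D) ^ m ≤ energy r θ s m μ := by
  rw [energy_eq_integral_prod hr hr1 hθ hs hsm]
  calc (r / D) ^ m = ∫ _, (r / D) ^ m ∂((μ : Measure (EuclideanSpace ℝ (Fin n))).prod
        (μ : Measure (EuclideanSpace ℝ (Fin n)))) := by simp
    _ ≤ _ := by
        refine integral_mono_ae (integrable_const _) (integrable_kernel_sub hr hr1 hθ hs hsm μ) ?_
        filter_upwards [ae_mem_prod_of_mem_measuresOn hμ] with z hz
        rw [kernel_eq_radialProfile hr hr1 hθ]
        refine le_radialProfile hr hr1 hθ hs hsm (lt_max_of_lt_right hr)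
          (max_le ?_ (hr1.trans hD)) hD
        rw [← dist_eq_norm]
        exact hK _ hz.1 _ hz.2

lemma measuresOn_nonempty {K : Set (EuclideanSpace ℝ (Fin n))} (hK : K.Nonempty) :
    (measuresOn K).Nonempty := by
  obtain ⟨x, hx⟩ := hK
  refine ⟨⟨Measure.dirac x, inferInstance⟩, ?_⟩
  change Measure.dirac x Kᶜ = 0
  simp [Measure.dirac_apply, hx]

lemma bddBelow_energy (hr : 0 < r) (hr1 : r ≤ 1) (hθ : θ ≤ 1)
    (S : Set (ProbabilityMeasure (EuclideanSpace ℝ (Fin n)))) :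
    BddBelow (energy r θ s m '' S) :=
  ⟨0, by rintro _ ⟨μ, _, rfl⟩; exact energy_nonneg hr hr1 hθ⟩

/-- The infimum of the energies over the measures supported on `closure F`. -/
def minEnergy (r θ s m : ℝ) (F : Set (EuclideanSpace ℝ (Fin n))) : ℝ :=
  sInf (energy r θ s m '' measuresOn (closure F))

lemma capacity_eq_inv_minEnergy : capacity r θ s m F = (minEnergy r θ s m F)⁻¹ := rfl

lemma minEnergy_le (hr : 0 < r) (hr1 : r ≤ 1) (hθ : θ ≤ 1) (hμ : μ ∈ measuresOn (closure F)) :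
    minEnergy r θ s m F ≤ energy r θ s m μ :=
  csInf_le (bddBelow_energy hr hr1 hθ _) ⟨μ, hμ, rfl⟩

lemma le_minEnergy (hF : F.Nonempty) {a : ℝ}
    (h : ∀ μ ∈ measuresOn (closure F), a ≤ energy r θ s m μ) : a ≤ minEnergy r θ s m F :=
  le_csInf ((measuresOn_nonempty hF.closure).image _) (by rintro _ ⟨μ, hμ, rfl⟩; exact h μ hμ)

lemma minEnergy_le_one (hr : 0 < r) (hr1 : r ≤ 1) (hθ : θ ≤ 1) (hs : 0 ≤ s) (hsm : s ≤ m)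
    (hF : F.Nonempty) : minEnergy r θ s m F ≤ 1 := by
  obtain ⟨μ, hμ⟩ := measuresOn_nonempty hF.closure
  exact (minEnergy_le hr hr1 hθ hμ).trans (energy_le_one hr hr1 hθ hs hsm)

lemma minEnergy_le_of_le (hr : 0 < r) (hr1 : r ≤ 1) (hθ : θ ≤ 1) (ht : 0 ≤ t) (hts : t ≤ s)
    (hsm : s ≤ m) (hF : F.Nonempty) : minEnergy r θ s m F ≤ minEnergy r θ t m F :=
  le_minEnergy hF fun _ hμ =>
    (minEnergy_le hr hr1 hθ hμ).trans (energy_le_of_le hr hr1 hθ ht hts hsm)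

lemma rpow_mul_minEnergy_le (hr : 0 < r) (hr1 : r ≤ 1) (hθ : θ ≤ 1) (ht : 0 ≤ t) (hts : t ≤ s)
    (hsm : s ≤ m) (hF : F.Nonempty) :
    r ^ ((1 - θ) * (s - t)) * minEnergy r θ t m F ≤ minEnergy r θ s m F :=
  le_minEnergy hF fun _ hμ =>
    (mul_le_mul_of_nonneg_left (minEnergy_le hr hr1 hθ hμ) (by positivity)).trans
      (rpow_mul_energy_le hr hr1 hθ ht hts hsm)

lemma exists_one_le_forall_dist_le (hF : Bornology.IsBounded F) :
    ∃ D : ℝ, 1 ≤ D ∧ ∀ x ∈ closure F, ∀ y ∈ closure F, dist x y ≤ D := by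
  obtain ⟨C, hC⟩ := Metric.isBounded_iff.1 hF.closure
  exact ⟨max 1 C, le_max_left _ _, fun x hx y hy => (hC hx hy).trans (le_max_right _ _)⟩

lemma minEnergy_pos (hr : 0 < r) (hr1 : r ≤ 1) (hθ : θ ≤ 1) (hs : 0 ≤ s) (hsm : s ≤ m)
    (hne : F.Nonempty) (hF : Bornology.IsBounded F) : 0 < minEnergy r θ s m F := by
  obtain ⟨D, hD, hFD⟩ := exists_one_le_forall_dist_le hF
  exact (show 0 < (r / D) ^ m by positivity).trans_le
    (le_minEnergy hne fun μ hμ => le_energy hr hr1 hθ hs hsm hD hFD hμ)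

lemma logCapacityRatio_eq :
    logCapacityRatio r θ s m F = Real.log (minEnergy r θ s m F) / Real.log r := by
  rw [logCapacityRatio, capacity_eq_inv_minEnergy, Real.log_inv, neg_div_neg_eq]

lemma logCapacityRatio_nonneg (hr : 0 < r) (hr1 : r < 1) (hθ : θ ≤ 1) (hs : 0 ≤ s) (hsm : s ≤ m)
    (hne : F.Nonempty) : 0 ≤ logCapacityRatio r θ s m F := by
  rw [logCapacityRatio_eq]
  refine div_nonneg_of_nonpos (Real.log_nonpos ?_ (minEnergy_le_one hr hr1.le hθ hs hsm hne))
    (Real.log_nonpos hr.le hr1.le)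
  exact le_minEnergy hne fun μ _ => energy_nonneg hr hr1.le hθ

lemma logCapacityRatio_le_iff {a : ℝ} (hr : 0 < r) (hr1 : r < 1) (hE : 0 < minEnergy r θ s m F) :
    logCapacityRatio r θ s m F ≤ a ↔ r ^ a ≤ minEnergy r θ s m F := by
  rw [logCapacityRatio_eq, div_le_iff_of_neg (Real.log_neg hr hr1), ← Real.log_rpow hr,
    Real.log_le_log_iff (by positivity) hE]

lemma logCapacityRatio_mono (hr : 0 < r) (hr1 : r < 1) (hθ : θ ≤ 1) (ht : 0 ≤ t) (hts : t ≤ s)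
    (hsm : s ≤ m) (hne : F.Nonempty) (hF : Bornology.IsBounded F) :
    logCapacityRatio r θ t m F ≤ logCapacityRatio r θ s m F := by
  rw [logCapacityRatio_eq, logCapacityRatio_eq]
  exact div_le_div_of_nonpos_of_le (Real.log_neg hr hr1).le
    (Real.log_le_log (minEnergy_pos hr hr1.le hθ (ht.trans hts) hsm hne hF)
      (minEnergy_le_of_le hr hr1.le hθ ht hts hsm hne))

/-- Multiplicative loss r^((1-θ)(s-t)) in energy becomes additive after dividing logarithms by log r
< 0. The slope 1-θ < 1 is what makes the profile equation uniquely solvable. -/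
lemma logCapacityRatio_le_add (hr : 0 < r) (hr1 : r < 1) (hθ : θ ≤ 1) (ht : 0 ≤ t) (hts : t ≤ s)
    (hsm : s ≤ m) (hne : F.Nonempty) (hF : Bornology.IsBounded F) :
    logCapacityRatio r θ s m F ≤ logCapacityRatio r θ t m F + (1 - θ) * (s - t) := by
  have hE := minEnergy_pos hr hr1.le hθ ht (hts.trans hsm) hne hF
  rw [logCapacityRatio_le_iff hr hr1 (minEnergy_pos hr hr1.le hθ (ht.trans hts) hsm hne hF),
    Real.rpow_add hr, mul_comm]
  refine le_trans ?_ (rpow_mul_minEnergy_le hr hr1.le hθ ht hts hsm hne)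
  gcongr
  exact (logCapacityRatio_le_iff hr hr1 hE).1 le_rfl

lemma logCapacityRatio_le_dim_add {D : ℝ} (hr : 0 < r) (hr1 : r < 1) (hθ : θ ≤ 1) (hs : 0 ≤ s)
    (hsm : s ≤ m) (hne : F.Nonempty) (hD : 1 ≤ D)
    (hFD : ∀ x ∈ closure F, ∀ y ∈ closure F, dist x y ≤ D) :
    logCapacityRatio r θ s m F ≤ m - m * Real.log D / Real.log r := by
  have h := le_minEnergy hne fun μ hμ => le_energy hr hr1.le hθ hs hsm hD hFD hμ
  have hD0 : 0 < D := by linarith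
  have hl := Real.log_neg hr hr1
  rw [logCapacityRatio_eq, div_le_iff_of_neg hl, sub_mul, div_mul_cancel₀ _ hl.ne, ← mul_sub,
    ← Real.log_div hr.ne' hD0.ne', ← Real.log_rpow (by positivity)]
  exact Real.log_le_log (by positivity) h

end Energy

/-! ### From covers to lower bounds on energy. -/

section CoverLowerBound

variable {n : ℕ} {r θ s m δ : ℝ} {F : Set (EuclideanSpace ℝ (Fin n))}
  {μ : ProbabilityMeasure (EuclideanSpace ℝ (Fin n))}

lemma radialProfile_of_le_rpow {d : ℝ} (hd : 0 < d) (hdR : d ≤ r ^ θ) :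
    radialProfile r θ s m d = (r / d) ^ s := by
  rw [radialProfile, min_eq_left ((one_le_div hd).2 hdR), Real.one_rpow, mul_one]

/-- Only the diagonal blocks `E i ×ˢ E i` are kept; there the decreasing kernel is at least its
value at distance `d i`, which lies in the middle range. -/
lemma sum_rpow_mul_sq_le_energy (hr : 0 < r) (hr1 : r ≤ 1) (hθ : θ ≤ 1) (hs : 0 ≤ s) (hsm : s ≤ m)
    {N : ℕ} {E : Fin N → Set (EuclideanSpace ℝ (Fin n))} {d : Fin N → ℝ}
    (hE : ∀ i, MeasurableSet (E i)) (hdisj : Pairwise (Function.onFun Disjoint E))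
    (hd : ∀ i, r ≤ d i) (hdR : ∀ i, d i ≤ r ^ θ)
    (hdist : ∀ i, ∀ x ∈ E i, ∀ y ∈ E i, dist x y ≤ d i) :
    ∑ i, (r / d i) ^ s * (μ : Measure (EuclideanSpace ℝ (Fin n))).real (E i) ^ 2 ≤
      energy r θ s m μ := by
  rw [energy_eq_integral_prod hr hr1 hθ hs hsm]
  set ν := (μ : Measure (EuclideanSpace ℝ (Fin n))).prod (μ : Measure (EuclideanSpace ℝ (Fin n)))
  have hm : ∀ i, MeasurableSet (E i ×ˢ E i) := fun i => (hE i).prod (hE i)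
  have hint : ∀ i ∈ Finset.univ, Integrable
      ((E i ×ˢ E i).indicator fun _ => (r / d i) ^ s) ν := fun i _ =>
    (integrable_const _).indicator (hm i)
  calc _ = ∑ i, ∫ z, (E i ×ˢ E i).indicator (fun _ => (r / d i) ^ s) z ∂ν := by
        refine Finset.sum_congr rfl fun i _ => ?_
        rw [integral_indicator_const _ (hm i), measureReal_prod_prod, smul_eq_mul]
        ring
    _ = ∫ z, ∑ i, (E i ×ˢ E i).indicator (fun _ => (r / d i) ^ s) z ∂ν :=
        (integral_finsetSum _ hint).symm
    _ ≤ _ := by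
        refine integral_mono (integrable_finsetSum _ hint)
          (integrable_kernel_sub hr hr1 hθ hs hsm μ) fun z => ?_
        by_cases h : ∃ i, z ∈ E i ×ˢ E i
        · obtain ⟨i, hi⟩ := h
          simp only
          rw [Finset.sum_eq_single i, Set.indicator_of_mem hi, kernel_eq_radialProfile hr hr1 hθ,
            ← radialProfile_of_le_rpow (m := m) (hr.trans_le (hd i)) (hdR i)]
          · refine radialProfile_anti hr hs hsm (lt_max_of_lt_right hr) (max_le ?_ (hd i))
            rw [← dist_eq_norm]
            exact hdist i _ hi.1 _ hi.2
          · intro j _ hji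
            refine Set.indicator_of_notMem (fun hj => ?_) _
            exact Set.disjoint_left.1 (hdisj hji) hj.1 hi.1
          · simp
        · push Not at h
          simp only
          rw [Finset.sum_eq_zero fun i _ => Set.indicator_of_notMem (h i) _]
          exact kernel_nonneg hr hr1 hθ

/-- Cauchy–Schwarz on the disjointed pieces, whose masses sum to at least 1. -/
lemma rpow_div_sum_rpow_le_energy (hr : 0 < r) (hr1 : r ≤ 1) (hθ : θ ≤ 1) (hs : 0 ≤ s)
    (hsm : s ≤ m) {N : ℕ} {U : Fin N → Set (EuclideanSpace ℝ (Fin n))} {d : Fin N → ℝ}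
    (hU : ∀ i, MeasurableSet (U i)) {K : Set (EuclideanSpace ℝ (Fin n))} (hK : K ⊆ ⋃ i, U i)
    (hd : ∀ i, r ≤ d i) (hdR : ∀ i, d i ≤ r ^ θ)
    (hdist : ∀ i, ∀ x ∈ U i, ∀ y ∈ U i, dist x y ≤ d i) (hμ : μ ∈ measuresOn K) :
    r ^ s / ∑ i, d i ^ s ≤ energy r θ s m μ := by
  have hsub := fun i => disjointed_subset U i
  have hmeas : ∀ i, MeasurableSet (disjointed U i) := fun i =>
    disjointedRec (fun _ _ h => h.diff (hU _)) (hU i)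
  have hdisj := disjoint_disjointed U
  refine le_trans ?_ (sum_rpow_mul_sq_le_energy hr hr1 hθ hs hsm hmeas hdisj hd hdR
    fun i x hx y hy => hdist i x (hsub i hx) y (hsub i hy))
  have hone : 1 ≤ ∑ i, (μ : Measure (EuclideanSpace ℝ (Fin n))).real (disjointed U i) := by
    rw [← measureReal_iUnion_fintype hdisj hmeas, iUnion_disjointed]
    have h0 : (μ : Measure (EuclideanSpace ℝ (Fin n))) (⋃ i, U i)ᶜ = 0 :=
      measure_mono_null (Set.compl_subset_compl.2 hK) hμ
    have h1 := (prob_compl_eq_zero_iff (MeasurableSet.iUnion hU)).1 h0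
    simp [measureReal_def, h1]
  have hd0 : ∀ i, 0 < d i := fun i => hr.trans_le (hd i)
  have hpos : ∀ i ∈ Finset.univ, 0 < d i ^ s := fun i _ => Real.rpow_pos_of_pos (hd0 i) _
  calc r ^ s / ∑ i, d i ^ s
      ≤ r ^ s * ((∑ i, (μ : Measure (EuclideanSpace ℝ (Fin n))).real (disjointed U i)) ^ 2 /
          ∑ i, d i ^ s) := by
        rw [div_eq_mul_one_div]
        have := Finset.sum_nonneg fun i hi => (hpos i hi).le
        gcongr
        exact one_le_pow₀ hone
    _ ≤ r ^ s * ∑ i, (μ : Measure (EuclideanSpace ℝ (Fin n))).real (disjointed U i) ^ 2 /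
          d i ^ s := by
        gcongr
        exact Finset.sq_sum_div_le_sum_sq_div _ _ hpos
    _ = _ := by
        rw [Finset.mul_sum]
        refine Finset.sum_congr rfl fun i _ => ?_
        rw [Real.div_rpow hr.le (hd0 i).le]
        ring

/-- The summands are bounded below by a positive constant. Finiteness matters because the measures
live on `closure F`, and closures of the pieces cover it only when the union is finite. -/
lemma IsAdmissibleCover.finite (hδ : 0 < δ) {𝒰 : Set (Set (EuclideanSpace ℝ (Fin n)))}
    (h : IsAdmissibleCover θ δ F 𝒰) (hs : 0 ≤ s)
    (hsum : ∑' U : 𝒰, Metric.ediam U.1 ^ s ≠ ∞) : 𝒰.Finite := by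
  have hε : ENNReal.ofReal (δ ^ (1 / θ)) ^ s ≠ 0 := by
    rw [ENNReal.ofReal_rpow_of_pos (by positivity)]
    simpa using Real.rpow_pos_of_pos (Real.rpow_pos_of_pos hδ _) _
  have hfin := ENNReal.finite_const_le_of_tsum_ne_top hsum hε
  have huniv : {U : 𝒰 | ENNReal.ofReal (δ ^ (1 / θ)) ^ s ≤ Metric.ediam U.1 ^ s} = Set.univ :=
    Set.eq_univ_of_forall fun U => ENNReal.rpow_le_rpow (h.2.2 U U.2).1 hs
  rw [huniv] at hfin
  exact Set.finite_coe_iff.1 (Set.finite_univ_iff.1 hfin)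

lemma rpow_le_minEnergy_of_hasCoverWithSum (hδ : 0 < δ) (hδ1 : δ ≤ 1) (hθ0 : 0 < θ) (hθ : θ ≤ 1)
    (hs : 0 ≤ s) (hsm : s ≤ m) (hne : F.Nonempty) (h : HasCoverWithSum θ δ s 1 F) :
    (δ ^ (1 / θ)) ^ s ≤ minEnergy (δ ^ (1 / θ)) θ s m F := by
  obtain ⟨𝒰, hadm, hsum⟩ := h
  set r := δ ^ (1 / θ) with hrdef
  have hr : 0 < r := by positivity
  have hr1 : r ≤ 1 := Real.rpow_le_one hδ.le hδ1 (by positivity)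
  have hrθ : r ^ θ = δ := by
    rw [hrdef, ← Real.rpow_mul hδ.le, one_div_mul_cancel hθ0.ne', Real.rpow_one]
  have hfin : 𝒰.Finite := hadm.finite hδ hs (ne_top_of_le_ne_top ENNReal.ofReal_ne_top hsum)
  have := hfin.fintype
  let e := Fintype.equivFin 𝒰
  have htop : ∀ U ∈ 𝒰, Metric.ediam U ≠ ∞ := fun U hU =>
    ne_top_of_le_ne_top ENNReal.ofReal_ne_top (hadm.2.2 U hU).2
  have hsum' : ∑ i, (Metric.ediam (e.symm i).1).toReal ^ s ≤ 1 := by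
    rw [tsum_fintype, ← e.symm.sum_comp] at hsum
    have := ENNReal.toReal_mono ENNReal.ofReal_ne_top hsum
    rw [ENNReal.toReal_sum fun i _ => ENNReal.rpow_ne_top_of_nonneg hs (htop _ (e.symm i).2)] at this
    simpa [ENNReal.toReal_rpow] using this
  refine le_minEnergy hne fun μ hμ => ?_
  have key := rpow_div_sum_rpow_le_energy (μ := μ) (K := closure F) hr hr1 hθ hs hsm
    (U := fun i => closure (e.symm i).1) (d := fun i => (Metric.ediam (e.symm i).1).toReal)
    (fun i => isClosed_closure.measurableSet) ?_ ?_ ?_ ?_ hμ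
  · refine le_trans ?_ key
    have hpos : 0 < ∑ i, (Metric.ediam (e.symm i).1).toReal ^ s := by
      refine Finset.sum_pos (fun i _ => Real.rpow_pos_of_pos (hr.trans_le ?_) _) ?_
      · exact (ENNReal.ofReal_le_iff_le_toReal (htop _ (e.symm i).2)).1
          (hadm.2.2 _ (e.symm i).2).1
      · obtain ⟨x, hx⟩ := hne
        obtain ⟨U, hU, _⟩ := hadm.2.1 hx
        exact ⟨e ⟨U, hU⟩, Finset.mem_univ _⟩
    rw [le_div_iff₀ hpos]
    exact mul_le_of_le_one_right (by positivity) hsum'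
  · rw [← closure_iUnion_of_finite]
    refine closure_mono fun x hx => ?_
    obtain ⟨U, hU, hxU⟩ := hadm.2.1 hx
    exact Set.mem_iUnion.2 ⟨e ⟨U, hU⟩, by simpa using hxU⟩
  · exact fun i => (ENNReal.ofReal_le_iff_le_toReal (htop _ (e.symm i).2)).1
      (hadm.2.2 _ (e.symm i).2).1
  · intro i
    rw [hrθ]
    exact ENNReal.toReal_le_of_le_ofReal hδ.le (hadm.2.2 _ (e.symm i).2).2
  · intro i x hx y hy
    rw [dist_edist]
    refine ENNReal.toReal_mono (htop _ (e.symm i).2) ?_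
    rw [← Metric.ediam_closure]
    exact Metric.edist_le_ediam_of_mem hx hy

end CoverLowerBound

/-! ### Ball coverings, discrete minimisers, and dyadic pigeonholing. -/

section Discrete

variable {n : ℕ}

/-- Vitali applied to a finite η-net gives disjoint η-balls inside the ball of radius R + η;
comparing volumes bounds their number. -/
lemma exists_finset_cover_closedBall (x : EuclideanSpace ℝ (Fin n)) {R η : ℝ} (hR : 0 ≤ R)
    (hη : 0 < η) :
    ∃ u : Finset (EuclideanSpace ℝ (Fin n)),
      Metric.closedBall x R ⊆ ⋃ y ∈ u, Metric.closedBall y (5 * η) ∧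
        (u.card : ℝ) ≤ ((R + η) / η) ^ n := by
  obtain ⟨t, htR, htfin, htcov⟩ := Metric.finite_approx_of_totallyBounded
    (isCompact_closedBall x R).totallyBounded η hη
  obtain ⟨u, hut, hdisj, hcov⟩ := Vitali.exists_disjoint_subfamily_covering_enlargement_closedBall
    t id (fun _ => η) η (fun _ _ => le_rfl) 5 (by norm_num)
  have hufin := htfin.subset hut
  refine ⟨hufin.toFinset, fun y hy => ?_, ?_⟩
  · obtain ⟨a, ha, hya⟩ := Set.mem_iUnion₂.1 (htcov hy)
    obtain ⟨b, hb, hab⟩ := hcov a ha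
    exact Set.mem_iUnion₂.2 ⟨b, by simpa using hb, hab (Metric.ball_subset_closedBall hya)⟩
  · have hball : 0 < (volume : Measure (EuclideanSpace ℝ (Fin n))).real (Metric.ball 0 1) :=
      ENNReal.toReal_pos (Metric.measure_ball_pos _ _ one_pos).ne' measure_ball_lt_top.ne
    have hvol : ∀ (y : EuclideanSpace ℝ (Fin n)) {ρ : ℝ}, 0 ≤ ρ →
        (volume : Measure (EuclideanSpace ℝ (Fin n))).real (Metric.closedBall y ρ) =
          ρ ^ n * (volume : Measure (EuclideanSpace ℝ (Fin n))).real (Metric.ball 0 1) := by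
      intro y ρ hρ
      simp [measureReal_def, Measure.addHaar_closedBall _ y hρ, ENNReal.toReal_mul, hρ]
    have hsub : ⋃ y ∈ hufin.toFinset, Metric.closedBall y η ⊆ Metric.closedBall x (R + η) := by
      refine Set.iUnion₂_subset fun y hy => Metric.closedBall_subset_closedBall' ?_
      have := Metric.mem_closedBall.1 (htR (hut (by simpa using hy)))
      linarith
    have h := measureReal_mono (μ := volume) hsub measure_closedBall_lt_top.ne
    rw [measureReal_biUnion_finset (by simpa using hdisj)
      (fun _ _ => Metric.isClosed_closedBall.measurableSet)
      (fun _ _ => measure_closedBall_lt_top.ne), hvol x (by positivity)] at h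
    simp only [hvol _ hη.le, Finset.sum_const, nsmul_eq_mul, ← mul_assoc] at h
    have h' := le_of_mul_le_mul_right h hball
    rw [div_pow, le_div_iff₀ (by positivity)]
    exact h'

open Matrix in
-- First variation at a minimiser of the quadratic form, moving towards the vertex `i`. The
-- inequality holds at every `i`, including those of zero weight.
lemma exists_stdSimplex_forall_quadratic_le {ι : Type*} [Fintype ι] [Nonempty ι]
    (K : Matrix ι ι ℝ) (hK : K.IsSymm) :
    ∃ w ∈ stdSimplex ℝ ι, ∀ i, w ⬝ᵥ K *ᵥ w ≤ (K *ᵥ w) i := by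
  classical
  obtain ⟨w, hw, hmin⟩ := (isCompact_stdSimplex ℝ ι).exists_isMinOn
    ⟨_, single_mem_stdSimplex ℝ (Classical.arbitrary ι)⟩
    (f := fun w => w ⬝ᵥ K *ᵥ w) (by fun_prop)
  refine ⟨w, hw, fun i => ?_⟩
  set h : ι → ℝ := Pi.single i 1 - w with hh
  have hsymm : w ⬝ᵥ K *ᵥ h = h ⬝ᵥ K *ᵥ w := by
    rw [dotProduct_mulVec, ← mulVec_transpose, hK.eq, dotProduct_comm]
  have hexp : ∀ ε ∈ Set.Ioc (0 : ℝ) 1, 0 ≤ 2 * (h ⬝ᵥ K *ᵥ w) + ε * (h ⬝ᵥ K *ᵥ h) := by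
    intro ε hε
    have hmem : w + ε • h ∈ stdSimplex ℝ ι := by
      have := convex_stdSimplex ℝ ι hw (single_mem_stdSimplex ℝ i) (sub_nonneg.2 hε.2) hε.1.le
        (by ring)
      convert this using 1
      rw [hh]
      module
    have h1 : w ⬝ᵥ K *ᵥ w ≤ (w + ε • h) ⬝ᵥ K *ᵥ (w + ε • h) := hmin hmem
    simp only [mulVec_add, mulVec_smul, add_dotProduct, dotProduct_add, smul_dotProduct,
      dotProduct_smul, hsymm, smul_eq_mul] at h1
    have : 0 ≤ ε * (2 * (h ⬝ᵥ K *ᵥ w) + ε * (h ⬝ᵥ K *ᵥ h)) := by linarith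
    exact nonneg_of_mul_nonneg_right this hε.1
  -- Letting ε tend to 0 leaves the linear term, the directional derivative.
  have hlim : Tendsto (fun ε : ℝ => 2 * (h ⬝ᵥ K *ᵥ w) + ε * (h ⬝ᵥ K *ᵥ h)) (𝓝[>] 0)
      (𝓝 (2 * (h ⬝ᵥ K *ᵥ w) + 0 * (h ⬝ᵥ K *ᵥ h))) :=
    ((tendsto_id.mul_const _).const_add _).mono_left nhdsWithin_le_nhds
  have hfin := ge_of_tendsto hlim (by
    filter_upwards [Ioc_mem_nhdsGT (one_pos : (0 : ℝ) < 1)] with ε hε using hexp ε hε)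
  rw [hh, sub_dotProduct, single_one_dotProduct] at hfin
  linarith

variable {r θ s : ℝ} {F : Set (EuclideanSpace ℝ (Fin n))}

open Matrix in
lemma minEnergy_le_quadratic {m : ℝ} (hr : 0 < r) (hr1 : r ≤ 1) (hθ : θ ≤ 1) {ι : Type*} [Fintype ι]
    (x : ι → EuclideanSpace ℝ (Fin n)) (hx : ∀ i, x i ∈ F) {w : ι → ℝ} (hw : w ∈ stdSimplex ℝ ι) :
    minEnergy r θ s m F ≤ w ⬝ᵥ (Matrix.of fun i j => kernel r θ s m (x i - x j)) *ᵥ w := by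
  let ν : Measure (EuclideanSpace ℝ (Fin n)) :=
    ∑ i, ENNReal.ofReal (w i) • Measure.dirac (x i)
  have hν : IsProbabilityMeasure ν := by
    constructor
    simp only [ν, Measure.coe_finsetSum, Finset.sum_apply, Measure.smul_apply, measure_univ,
      smul_eq_mul, mul_one]
    rw [← ENNReal.ofReal_sum_of_nonneg fun i _ => hw.1 i, hw.2, ENNReal.ofReal_one]
  have hint : ∀ f : EuclideanSpace ℝ (Fin n) → ℝ, ∫ y, f y ∂ν = ∑ i, w i * f (x i) := by
    intro f
    rw [integral_finsetSum_measure fun i _ =>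
      (integrable_dirac (by simp)).smul_measure ENNReal.ofReal_ne_top]
    refine Finset.sum_congr rfl fun i _ => ?_
    rw [integral_smul_measure, integral_dirac, ENNReal.toReal_ofReal (hw.1 i), smul_eq_mul]
  have hmem : (⟨ν, hν⟩ : ProbabilityMeasure (EuclideanSpace ℝ (Fin n))) ∈
      measuresOn (closure F) := by
    change ν (closure F)ᶜ = 0
    have hxF : ∀ i, x i ∈ closure F := fun i => subset_closure (hx i)
    simp [ν, Measure.dirac_apply, hxF]
  refine (minEnergy_le hr hr1 hθ hmem).trans_eq ?_
  change ∫ y, ∫ z, kernel r θ s m (z - y) ∂ν ∂ν = _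
  simp only [hint, dotProduct, mulVec, Matrix.of_apply]
  refine Finset.sum_congr rfl fun i _ => ?_
  congr 1
  refine Finset.sum_congr rfl fun j _ => ?_
  rw [← kernel_neg, neg_sub, mul_comm]

/-- The term with the least k such that ‖x‖ ≤ 2^k r already suffices: for k ≥ 1 the norm exceeds
2^(k-1) r, and doubling absorbs the lost factor 2. -/
lemma kernel_le_sum_dyadic {m : ℝ} (hr : 0 < r) (hr1 : r ≤ 1) (hθ : θ ≤ 1) (hs : 0 ≤ s)
    (hsm : s ≤ m) {M : ℕ} {x : EuclideanSpace ℝ (Fin n)} (hx : ‖x‖ ≤ 2 ^ M * r) :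
    kernel r θ s m x ≤ ∑ k ∈ Finset.range (M + 1),
      2 ^ m * radialProfile r θ s m (2 ^ k * r) * (if ‖x‖ ≤ 2 ^ k * r then 1 else 0) := by
  classical
  have hex : ∃ k : ℕ, ‖x‖ ≤ 2 ^ k * r := ⟨M, hx⟩
  have hp : ∀ k : ℕ, 0 < radialProfile r θ s m (2 ^ k * r) := fun k =>
    radialProfile_pos hr (by positivity)
  have hspec := Nat.find_spec hex
  have hkM : Nat.find hex ≤ M := Nat.find_le hx
  refine le_trans ?_ (Finset.single_le_sum (a := Nat.find hex) (fun k _ => ?_)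
    (Finset.mem_range.2 (Nat.lt_succ_of_le hkM)))
  · rw [if_pos hspec, mul_one, kernel_eq_radialProfile hr hr1 hθ]
    rcases hk : Nat.find hex with _ | k
    · rw [hk] at hspec
      simp only [pow_zero, one_mul] at hspec ⊢
      rw [max_eq_right hspec]
      exact le_mul_of_one_le_left (radialProfile_pos hr hr).le
        (Real.one_le_rpow (by norm_num) (hs.trans hsm))
    · have hlt : ¬ ‖x‖ ≤ 2 ^ k * r := Nat.find_min hex (by omega)
      push Not at hlt
      have hkr : 0 < 2 ^ k * r := by positivity
      rw [pow_succ', mul_assoc]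
      exact (radialProfile_anti hr hs hsm hkr (hlt.le.trans (le_max_left _ _))).trans
        (radialProfile_doubling hr hsm hkr)
  · have := hp k
    positivity

open Matrix in
-- Pigeonhole: one of the M + 1 dyadic scales carries at least an average share of the potential.
lemma exists_ball_mass_ge {m : ℝ} (hr : 0 < r) (hr1 : r ≤ 1) (hθ : θ ≤ 1) (hs : 0 ≤ s)
    (hsm : s ≤ m) {ι : Type*} [Fintype ι] {x : ι → EuclideanSpace ℝ (Fin n)} {w : ι → ℝ}
    (hw : ∀ i, 0 ≤ w i) {M : ℕ} (i : ι) (hM : ∀ j, dist (x j) (x i) ≤ 2 ^ M * r) {γ : ℝ}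
    (hγ : γ ≤ ((Matrix.of fun i j => kernel r θ s m (x i - x j)) *ᵥ w) i) :
    ∃ k : ℕ, γ ≤ 2 ^ m * (M + 1) * radialProfile r θ s m (2 ^ k * r) *
      ∑ j with dist (x j) (x i) ≤ 2 ^ k * r, w j := by
  have h1 : γ ≤ ∑ k ∈ Finset.range (M + 1), 2 ^ m * radialProfile r θ s m (2 ^ k * r) *
      ∑ j with dist (x j) (x i) ≤ 2 ^ k * r, w j := by
    refine hγ.trans ?_
    simp only [mulVec, dotProduct, Matrix.of_apply]
    calc ∑ j, kernel r θ s m (x i - x j) * w j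
        ≤ ∑ j, (∑ k ∈ Finset.range (M + 1), 2 ^ m * radialProfile r θ s m (2 ^ k * r) *
            (if dist (x j) (x i) ≤ 2 ^ k * r then 1 else 0)) * w j := by
          refine Finset.sum_le_sum fun j _ => mul_le_mul_of_nonneg_right ?_ (hw j)
          have hd : ‖x i - x j‖ = dist (x j) (x i) := by rw [dist_comm, dist_eq_norm]
          have := kernel_le_sum_dyadic hr hr1 hθ hs hsm (hd.trans_le (hM j))
          rw [hd] at this
          exact this
      _ = _ := by
          simp only [Finset.sum_mul]
          rw [Finset.sum_comm]
          refine Finset.sum_congr rfl fun k _ => ?_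
          rw [Finset.mul_sum, Finset.sum_filter]
          refine Finset.sum_congr rfl fun j _ => ?_
          split_ifs <;> simp
  have h2 : ∑ k ∈ Finset.range (M + 1), γ / (M + 1) ≤ ∑ k ∈ Finset.range (M + 1),
      2 ^ m * radialProfile r θ s m (2 ^ k * r) *
      ∑ j with dist (x j) (x i) ≤ 2 ^ k * r, w j := by
    refine le_trans (le_of_eq ?_) h1
    rw [Finset.sum_const, Finset.card_range, nsmul_eq_mul]
    push_cast
    field_simp
  obtain ⟨k, -, hk⟩ := Finset.exists_le_of_sum_le (by simp) h2
  refine ⟨k, ?_⟩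
  rw [div_le_iff₀ (by positivity)] at hk
  linarith

end Discrete

/-! ### From minimal energy to covers. -/

section CapacityCover

variable {n : ℕ} {r θ s t : ℝ} {F : Set (EuclideanSpace ℝ (Fin n))}

/-- Equality, not just an upper bound, is needed for the lower diameter constraint; it fails in
dimension 0. -/
lemma ediam_closedBall_half (hn : 1 ≤ n) (x : EuclideanSpace ℝ (Fin n)) {d : ℝ} (hd : 0 ≤ d) :
    Metric.ediam (Metric.closedBall x (d / 2)) = ENNReal.ofReal d := by
  have : Nonempty (Fin n) := ⟨⟨0, hn⟩⟩
  have h := Metric.diam_closedBall_eq x (show 0 ≤ d / 2 by positivity)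
  rw [mul_div_cancel₀ _ two_ne_zero] at h
  rw [Metric.diam] at h
  conv_rhs => rw [← h, ENNReal.ofReal_toReal Metric.isBounded_closedBall.ediam_ne_top]

lemma hasCoverWithSum_of_finset (hn : 1 ≤ n) {δ ε : ℝ} {ι : Type*} (S : Finset ι)
    (y : ι → EuclideanSpace ℝ (Fin n)) (d : ι → ℝ) (hδ : 0 < δ)
    (hd : ∀ i ∈ S, δ ^ (1 / θ) ≤ d i) (hd' : ∀ i ∈ S, d i ≤ δ)
    (hcov : F ⊆ ⋃ i ∈ S, Metric.closedBall (y i) (d i / 2)) (hsum : ∑ i ∈ S, d i ^ s ≤ ε) :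
    HasCoverWithSum θ δ s ε F := by
  classical
  have hd0 : ∀ i ∈ S, 0 < d i := fun i hi => (Real.rpow_pos_of_pos hδ _).trans_le (hd i hi)
  let 𝒱 := S.image fun i => Metric.closedBall (y i) (d i / 2)
  refine ⟨𝒱, ⟨𝒱.countable_toSet, fun x hx => ?_, fun U hU => ?_⟩, ?_⟩
  · obtain ⟨i, hi, hxi⟩ := Set.mem_iUnion₂.1 (hcov hx)
    exact ⟨_, Finset.mem_image_of_mem _ hi, hxi⟩
  · obtain ⟨i, hi, rfl⟩ := Finset.mem_image.1 (Finset.mem_coe.1 hU)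
    rw [ediam_closedBall_half hn _ (hd0 i hi).le]
    exact ⟨ENNReal.ofReal_le_ofReal (hd i hi), ENNReal.ofReal_le_ofReal (hd' i hi)⟩
  · calc ∑' U : (𝒱 : Set (Set (EuclideanSpace ℝ (Fin n)))), Metric.ediam U.1 ^ s
        = ∑ U ∈ 𝒱, Metric.ediam U ^ s :=
          Finset.tsum_subtype' 𝒱 fun U => Metric.ediam U ^ s
      _ ≤ ∑ i ∈ S, Metric.ediam (Metric.closedBall (y i) (d i / 2)) ^ s :=
          Finset.sum_image_le_of_nonneg fun _ _ => zero_le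
      _ = ∑ i ∈ S, ENNReal.ofReal (d i ^ s) :=
          Finset.sum_congr rfl fun i hi => by
            rw [ediam_closedBall_half hn _ (hd0 i hi).le, ENNReal.ofReal_rpow_of_pos (hd0 i hi)]
      _ = ENNReal.ofReal (∑ i ∈ S, d i ^ s) :=
          (ENNReal.ofReal_sum_of_nonneg fun i hi => Real.rpow_nonneg (hd0 i hi).le _).symm
      _ ≤ _ := ENNReal.ofReal_le_ofReal hsum

open Matrix in
/-- A measure of almost minimal energy yields finitely many disjoint balls of large relative mass
whose enlargements cover `F`. -/
lemma exists_balls_cover {m : ℝ} (hr : 0 < r) (hr1 : r ≤ 1) (hθ : θ ≤ 1) (ht : 0 ≤ t) (htm : t ≤ m)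
    (hne : F.Nonempty) (hF : Bornology.IsBounded F) {M : ℕ}
    (hM : ∀ x ∈ F, ∀ y ∈ F, dist x y ≤ 2 ^ M * r) :
    ∃ (u : Finset (EuclideanSpace ℝ (Fin n))) (ρ a : EuclideanSpace ℝ (Fin n) → ℝ),
      (∀ x ∈ u, r ≤ ρ x) ∧
      F ⊆ ⋃ x ∈ u, Metric.closedBall x (5 * ρ x) ∧
      (∀ x ∈ u, minEnergy r θ t m F ≤ 2 ^ m * (M + 1) * radialProfile r θ t m (ρ x) * a x) ∧
      ∑ x ∈ u, a x ≤ 1 := by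
  classical
  obtain ⟨T, hTF, hTfin, hTcov⟩ := Metric.finite_approx_of_totallyBounded
    (hF.isCompact_closure.totallyBounded.subset subset_closure) r hr
  have := hTfin.fintype
  have : Nonempty T := by
    obtain ⟨x, hx⟩ := hne
    obtain ⟨y, hy, -⟩ := Set.mem_iUnion₂.1 (hTcov hx)
    exact ⟨⟨y, hy⟩⟩
  let K : Matrix T T ℝ := Matrix.of fun i j => kernel r θ t m (i.1 - j.1)
  have hK : K.IsSymm := by
    ext i j
    simp only [K, Matrix.transpose_apply, Matrix.of_apply]
    rw [← kernel_neg, neg_sub]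
  obtain ⟨w, hw, hmin⟩ := exists_stdSimplex_forall_quadratic_le K hK
  -- Valid at all net points, so every one of them gets a heavy ball and the balls reach all of `F`.
  have hpot : ∀ i, minEnergy r θ t m F ≤ (K *ᵥ w) i := fun i =>
    (minEnergy_le_quadratic hr hr1 hθ (fun i : T => i.1) (fun i => hTF i.2) hw).trans (hmin i)
  choose k hk using fun i => exists_ball_mass_ge hr hr1 hθ ht htm hw.1 i
    (fun j => hM _ (hTF j.2) _ (hTF i.2)) (hpot i)
  obtain ⟨u, -, hdisj, hcov⟩ := Vitali.exists_disjoint_subfamily_covering_enlargement_closedBall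
    (Set.univ : Set T) (fun i => i.1) (fun i => 2 ^ k i * r) (∑ i, 2 ^ k i * r)
    (fun i _ => Finset.single_le_sum (f := fun i => 2 ^ k i * r) (fun _ _ => by positivity)
      (Finset.mem_univ i)) 5 (by norm_num)
  have hufin := u.toFinite
  -- The value 0 outside `T` plays no role, since only centres in `T` are selected.
  let ρ : EuclideanSpace ℝ (Fin n) → ℝ := fun x => if h : x ∈ T then 2 ^ k ⟨x, h⟩ * r else 0
  let a : EuclideanSpace ℝ (Fin n) → ℝ := fun x =>
    ∑ j : T with dist j.1 x ≤ ρ x, w j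
  have hρ : ∀ i : T, ρ i.1 = 2 ^ k i * r := fun i => dif_pos i.2
  have hinj : Set.InjOn (Subtype.val : T → EuclideanSpace ℝ (Fin n)) hufin.toFinset :=
    Subtype.val_injective.injOn
  refine ⟨hufin.toFinset.image Subtype.val, ρ, a, ?_, ?_, ?_, ?_⟩
  · simp only [Finset.mem_image, forall_exists_index, and_imp]
    rintro _ i - rfl
    rw [hρ]
    exact le_mul_of_one_le_left hr.le (one_le_pow₀ (by norm_num))
  · intro x hx
    obtain ⟨y, hy, hxy⟩ := Set.mem_iUnion₂.1 (hTcov hx)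
    obtain ⟨b, hb, hsub⟩ := hcov ⟨y, hy⟩ (Set.mem_univ _)
    refine Set.mem_iUnion₂.2 ⟨b.1, Finset.mem_image_of_mem _ (hufin.mem_toFinset.2 hb), ?_⟩
    rw [hρ]
    refine hsub (Metric.closedBall_subset_closedBall ?_ (Metric.ball_subset_closedBall hxy))
    exact le_mul_of_one_le_left hr.le (one_le_pow₀ (by norm_num))
  · simp only [Finset.mem_image, forall_exists_index, and_imp]
    rintro _ i - rfl
    simp only [a, hρ]
    exact hk i
  · rw [Finset.sum_image hinj]
    simp only [a, hρ]
    rw [← Finset.sum_biUnion]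
    · exact (Finset.sum_le_sum_of_subset_of_nonneg (Finset.subset_univ _)
        fun j _ _ => hw.1 j).trans hw.2.le
    · intro i hi j hj hij
      refine Finset.disjoint_left.2 fun l hl hl' => ?_
      exact Set.disjoint_left.1 (hdisj (hufin.mem_toFinset.1 hi) (hufin.mem_toFinset.1 hj) hij)
        (Metric.mem_closedBall.2 (Finset.mem_filter.1 hl).2)
        (Metric.mem_closedBall.2 (Finset.mem_filter.1 hl').2)

/-- The factor (M + 1) counts dyadic scales; r^(θ(s-t)) comes from raising the exponent on diameters
at most r^θ. -/
lemma hasCoverWithSum_of_minEnergy (hn : 1 ≤ n) (hr : 0 < r) (hr1 : r ≤ 1) (hθ0 : 0 < θ)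
    (hθ : θ ≤ 1) (ht : 0 ≤ t) (htn : t ≤ n) (hts : t ≤ s) (hne : F.Nonempty)
    (hF : Bornology.IsBounded F) {M : ℕ} (hM : ∀ x ∈ F, ∀ y ∈ F, dist x y ≤ 2 ^ M * r) :
    HasCoverWithSum θ (r ^ θ) s
      (r ^ (θ * (s - t)) * (102 ^ n * (M + 1) * (r ^ t / minEnergy r θ t n F))) F := by
  obtain ⟨u, ρ, a, hρ, hcov, hmass, ha⟩ := exists_balls_cover hr hr1 hθ ht htn hne hF hM
  set γ := minEnergy r θ t n F with hγ
  have hγ0 : 0 < γ := minEnergy_pos hr hr1 hθ ht htn hne hF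
  have hrR := le_rpow_self_of_le_one hr hr1 hθ
  let d : EuclideanSpace ℝ (Fin n) → ℝ := fun x => min (ρ x) (r ^ θ)
  have hd : ∀ x ∈ u, r ≤ d x := fun x hx => le_min (hρ x hx) hrR
  have hd0 : ∀ x ∈ u, 0 < d x := fun x hx => hr.trans_le (hd x hx)
  have hρ0 : ∀ x ∈ u, 0 < ρ x := fun x hx => hr.trans_le (hρ x hx)
  have hball : ∀ x ∈ u, ∃ c : Finset (EuclideanSpace ℝ (Fin n)),
      Metric.closedBall x (5 * ρ x) ⊆ ⋃ y ∈ c, Metric.closedBall y (d x / 2) ∧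
        (c.card : ℝ) ≤ 51 ^ n * (ρ x / d x) ^ n := by
    intro x hx
    have h0 := hd0 x hx
    have h1 := hρ0 x hx
    -- With η = d/10 the covering balls have radius 5η = d/2, hence diameter d. Since d ≤ ρ, (5ρ +
    -- η)/η ≤ 51 ρ/d; the constant 102 is 51 times the doubling factor 2.
    obtain ⟨c, hc, hcard⟩ := exists_finset_cover_closedBall x
      (show 0 ≤ 5 * ρ x by positivity) (show 0 < d x / 10 by positivity)
    refine ⟨c, ?_, hcard.trans ?_⟩
    · rwa [show 5 * (d x / 10) = d x / 2 by ring] at hc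
    · rw [← mul_pow]
      refine pow_le_pow_left₀ (by positivity) ?_ _
      rw [div_le_iff₀ (by positivity)]
      have h2 : d x ≤ ρ x := min_le_left _ _
      calc 5 * ρ x + d x / 10 ≤ 51 * ρ x / 10 := by linarith
        _ = 51 * (ρ x / d x) * (d x / 10) := by field_simp
  choose! c hc hcard using hball
  refine hasCoverWithSum_of_finset hn (u.sigma c) (fun p => p.2) (fun p => d p.1)
    (by positivity) ?_ ?_ ?_ ?_
  · intro p hp
    rw [← Real.rpow_mul hr.le, mul_one_div_cancel hθ0.ne', Real.rpow_one]
    exact hd _ (Finset.mem_sigma.1 hp).1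
  · exact fun p _ => min_le_right _ _
  · intro x hx
    obtain ⟨b, hb, hxb⟩ := Set.mem_iUnion₂.1 (hcov hx)
    obtain ⟨y, hy, hxy⟩ := Set.mem_iUnion₂.1 (hc b hb hxb)
    exact Set.mem_iUnion₂.2 ⟨⟨b, y⟩, Finset.mem_sigma.2 ⟨hb, hy⟩, hxy⟩
  · rw [Finset.sum_sigma]
    have hterm : ∀ x ∈ u, ∑ _y ∈ c x, d x ^ s ≤
        r ^ (θ * (s - t)) * (102 ^ n * (M + 1) * (r ^ t / γ)) * a x := by
      intro x hx
      have h0 := hd0 x hx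
      have h1 := hρ0 x hx
      have hP := radialProfile_pos (θ := θ) (s := t) (m := n) hr h1
      have hds : d x ^ s ≤ d x ^ t * r ^ (θ * (s - t)) := by
        have : d x ^ s = d x ^ t * d x ^ (s - t) := by
          rw [← Real.rpow_add h0]; congr 1; ring
        rw [this, Real.rpow_mul hr.le]
        have : 0 ≤ s - t := sub_nonneg.2 hts
        gcongr
        exact min_le_right _ _
      -- Here m = n is essential: the number of small balls grows with exponent n, the outer decay
      -- exponent of the kernel.
      have hcost : (ρ x / d x) ^ n * d x ^ t = r ^ t / radialProfile r θ t n (ρ x) := by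
        rw [← div_rpow_mul_rpow_eq hr h1, Real.rpow_natCast]
      have hm := hmass x hx
      rw [Real.rpow_natCast] at hm
      have hinv : r ^ t / radialProfile r θ t n (ρ x) ≤ 2 ^ n * (M + 1) * (r ^ t / γ) * a x := by
        rw [div_le_iff₀ hP]
        calc r ^ t = r ^ t / γ * γ := by field_simp
          _ ≤ r ^ t / γ * (2 ^ n * (M + 1) * radialProfile r θ t n (ρ x) * a x) := by gcongr
          _ = _ := by ring
      rw [Finset.sum_const, nsmul_eq_mul]
      calc (c x).card * d x ^ s
          ≤ (51 ^ n * (ρ x / d x) ^ n) * (d x ^ t * r ^ (θ * (s - t))) := by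
            gcongr
            exact hcard x hx
        _ = r ^ (θ * (s - t)) * 51 ^ n * ((ρ x / d x) ^ n * d x ^ t) := by ring
        _ ≤ r ^ (θ * (s - t)) * 51 ^ n * (2 ^ n * (M + 1) * (r ^ t / γ) * a x) := by
            rw [hcost]
            gcongr
        _ = _ := by
            rw [show (102 : ℝ) = 51 * 2 by norm_num, mul_pow]
            ring
    refine (Finset.sum_le_sum hterm).trans ?_
    rw [← Finset.mul_sum]
    exact mul_le_of_le_one_right (by positivity) ha

end CapacityCover

/-! ### Fixed points of nondecreasing functions with Lipschitz constant 1 - θ. -/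

section FixedPoint

variable {L : ℝ → EReal} {θ N : ℝ}

/-- If t < s, then s = L s ≤ t + (1-θ)(s-t), which contradicts θ > 0. -/
lemma le_of_isFixed_of_le (hθ : 0 < θ)
    (hlip : ∀ t s, 0 ≤ t → t ≤ s → s ≤ N → L s ≤ L t + ((1 - θ) * (s - t) : ℝ)) {s t : ℝ}
    (hs : s ≤ N) (hLs : L s = s) (ht : 0 ≤ t) (hLt : L t ≤ t) : s ≤ t := by
  by_contra! hts
  have h := (hlip t s ht hts.le hs).trans (add_le_add_left hLt _)
  rw [hLs, ← EReal.coe_add, EReal.coe_le_coe_iff] at h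
  nlinarith

/-- The bounds at the endpoints and monotonicity keep `L` finite, so the intermediate value theorem
applies to its real part minus the identity. -/
lemma exists_isFixed (hN : 0 ≤ N) (hθ : 0 ≤ θ)
    (hmono : ∀ t s, 0 ≤ t → t ≤ s → s ≤ N → L t ≤ L s)
    (hlip : ∀ t s, 0 ≤ t → t ≤ s → s ≤ N → L s ≤ L t + ((1 - θ) * (s - t) : ℝ))
    (h0 : 0 ≤ L 0) (hLN : L N ≤ N) : ∃ s ∈ Set.Icc 0 N, L s = s := by
  have hcoe : ∀ s ∈ Set.Icc 0 N, ((L s).toReal : EReal) = L s := fun s hs => by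
    refine EReal.coe_toReal ?_ ?_
    · exact ((hmono s N hs.1 hs.2 le_rfl).trans hLN).trans_lt (EReal.coe_lt_top N) |>.ne
    · exact ((EReal.bot_lt_zero).trans_le (h0.trans (hmono 0 s le_rfl hs.1 hs.2))).ne'
  have hmono' : ∀ t ∈ Set.Icc 0 N, ∀ s ∈ Set.Icc 0 N, t ≤ s → (L t).toReal ≤ (L s).toReal := by
    intro t ht s hs hts
    rw [← EReal.coe_le_coe_iff, hcoe t ht, hcoe s hs]
    exact hmono t s ht.1 hts hs.2
  have hlip' : ∀ t ∈ Set.Icc 0 N, ∀ s ∈ Set.Icc 0 N, t ≤ s →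
      (L s).toReal ≤ (L t).toReal + (s - t) := by
    intro t ht s hs hts
    have h := hlip t s ht.1 hts hs.2
    rw [← hcoe t ht, ← hcoe s hs, ← EReal.coe_add, EReal.coe_le_coe_iff] at h
    nlinarith
  have hcont : ContinuousOn (fun s => (L s).toReal) (Set.Icc 0 N) := by
    refine (LipschitzOnWith.of_dist_le_mul (K := 1) fun s hs t ht => ?_).continuousOn
    rw [Real.dist_eq, Real.dist_eq, NNReal.coe_one, one_mul]
    rcases le_total t s with h | h
    · have h1 := hmono' t ht s hs h
      have h2 := hlip' t ht s hs h
      rw [abs_of_nonneg (by linarith), abs_of_nonneg (by linarith)]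
      linarith
    · have h1 := hmono' s hs t ht h
      have h2 := hlip' s hs t ht h
      rw [abs_of_nonpos (by linarith), abs_of_nonpos (by linarith)]
      linarith
  have h0' : 0 ≤ (L 0).toReal := EReal.toReal_nonneg h0
  have hN' : (L N).toReal ≤ N := by
    rw [← EReal.coe_le_coe_iff, hcoe N ⟨hN, le_rfl⟩]
    exact hLN
  obtain ⟨s, hs, hs0⟩ := intermediate_value_Icc' hN (hcont.sub continuousOn_id)
    (show (0 : ℝ) ∈ Set.Icc ((L N).toReal - N) ((L 0).toReal - 0) from
      ⟨by linarith, by linarith⟩)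
  refine ⟨s, hs, ?_⟩
  rw [← hcoe s hs]
  exact congrArg _ (sub_eq_zero.1 hs0)

lemma exists_isFixed_and_unique (hN : 0 ≤ N) (hθ : 0 < θ)
    (hmono : ∀ t s, 0 ≤ t → t ≤ s → s ≤ N → L t ≤ L s)
    (hlip : ∀ t s, 0 ≤ t → t ≤ s → s ≤ N → L s ≤ L t + ((1 - θ) * (s - t) : ℝ))
    (h0 : 0 ≤ L 0) (hLN : L N ≤ N) :
    ∃ s, (s ∈ Set.Icc 0 N ∧ L s = s) ∧ (∀ t, t ∈ Set.Icc 0 N ∧ L t = t → t = s) ∧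
      ∀ t, 0 ≤ t → t ≤ N → L t ≤ t → s ≤ t := by
  obtain ⟨s, hs, hLs⟩ := exists_isFixed hN hθ.le hmono hlip h0 hLN
  refine ⟨s, ⟨hs, hLs⟩, fun t ht => ?_, fun t ht _ hLt =>
    le_of_isFixed_of_le hθ hlip hs.2 hLs ht hLt⟩
  exact le_antisymm (le_of_isFixed_of_le hθ hlip ht.1.2 ht.2 hs.1 hLs.le)
    (le_of_isFixed_of_le hθ hlip hs.2 hLs ht.1.1 ht.2.le)

end FixedPoint

/-! ### Passage to the limit and proof of the theorem. -/

section Limits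

variable {n : ℕ} {θ s t m : ℝ} {F : Set (EuclideanSpace ℝ (Fin n))}

lemma monotone_add_coe (c : ℝ) : Monotone fun x : EReal => x + c := fun _ _ h =>
  add_le_add_left h _

lemma continuousAt_add_coe (c : ℝ) (x : EReal) : ContinuousAt (fun x : EReal => x + c) x :=
  ContinuousAt.comp (f := fun x : EReal => (x, (c : EReal))) (x := x)
    (EReal.continuousAt_add (p := (x, (c : EReal))) (by simp) (by simp))
    (continuousAt_id.prodMk continuousAt_const)

lemma liminf_add_coe {l : Filter ℝ} [l.NeBot] (f : ℝ → EReal) (c : ℝ) :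
    liminf (fun r => f r + c) l = liminf f l + c :=
  ((monotone_add_coe c).map_liminf_of_continuousAt f (continuousAt_add_coe c _)).symm

lemma limsup_add_coe {l : Filter ℝ} [l.NeBot] (f : ℝ → EReal) (c : ℝ) :
    limsup (fun r => f r + c) l = limsup f l + c :=
  ((monotone_add_coe c).map_limsup_of_continuousAt f (continuousAt_add_coe c _)).symm

lemma eventually_mem_Ioo : ∀ᶠ r : ℝ in 𝓝[>] 0, r ∈ Set.Ioo (0 : ℝ) 1 :=
  Ioo_mem_nhdsGT one_pos

lemma eventually_logCapacityRatio_mono (hθ : θ ≤ 1) (ht : 0 ≤ t) (hts : t ≤ s) (hsm : s ≤ m)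
    (hne : F.Nonempty) (hF : Bornology.IsBounded F) :
    ∀ᶠ r : ℝ in 𝓝[>] 0, (logCapacityRatio r θ t m F : EReal) ≤ logCapacityRatio r θ s m F := by
  filter_upwards [eventually_mem_Ioo] with r hr
  exact EReal.coe_le_coe_iff.2 (logCapacityRatio_mono hr.1 hr.2 hθ ht hts hsm hne hF)

lemma eventually_logCapacityRatio_le_add (hθ : θ ≤ 1) (ht : 0 ≤ t) (hts : t ≤ s) (hsm : s ≤ m)
    (hne : F.Nonempty) (hF : Bornology.IsBounded F) :
    ∀ᶠ r : ℝ in 𝓝[>] 0, (logCapacityRatio r θ s m F : EReal) ≤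
      logCapacityRatio r θ t m F + ((1 - θ) * (s - t) : ℝ) := by
  filter_upwards [eventually_mem_Ioo] with r hr
  rw [← EReal.coe_add]
  exact EReal.coe_le_coe_iff.2 (logCapacityRatio_le_add hr.1 hr.2 hθ ht hts hsm hne hF)

lemma eventually_logCapacityRatio_nonneg (hθ : θ ≤ 1) (hs : 0 ≤ s) (hsm : s ≤ m)
    (hne : F.Nonempty) :
    ∀ᶠ r : ℝ in 𝓝[>] 0, (0 : EReal) ≤ logCapacityRatio r θ s m F := by
  filter_upwards [eventually_mem_Ioo] with r hr
  exact EReal.coe_nonneg.2 (logCapacityRatio_nonneg hr.1 hr.2 hθ hs hsm hne)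

lemma limsup_logCapacityRatio_le (hθ : θ ≤ 1) (hs : 0 ≤ s) (hsm : s ≤ m)
    (hne : F.Nonempty) (hF : Bornology.IsBounded F) :
    limsup (fun r : ℝ => (logCapacityRatio r θ s m F : EReal)) (𝓝[>] 0) ≤ m := by
  obtain ⟨D, hD, hFD⟩ := exists_one_le_forall_dist_le hF
  have hlim : Tendsto (fun r : ℝ => ((m - m * Real.log D / Real.log r : ℝ) : EReal)) (𝓝[>] 0)
      (𝓝 (m : EReal)) := by
    refine (continuous_coe_real_ereal.tendsto m).comp ?_
    have := (Real.tendsto_log_nhdsGT_zero.const_div_atBot (m * Real.log D)).const_sub m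
    simpa using this
  rw [← hlim.limsup_eq]
  refine limsup_le_limsup ?_
  filter_upwards [eventually_mem_Ioo] with r hr
  exact EReal.coe_le_coe_iff.2 (logCapacityRatio_le_dim_add hr.1 hr.2 hθ hs hsm hne hD hFD)

lemma tendsto_rpow_nhdsGT_zero {a : ℝ} (ha : 0 < a) :
    Tendsto (fun r : ℝ => r ^ a) (𝓝[>] 0) (𝓝[>] 0) := by
  refine tendsto_nhdsWithin_iff.2 ⟨?_, ?_⟩
  · have := (Real.continuousAt_rpow_const 0 a (Or.inr ha.le)).tendsto
    rw [Real.zero_rpow ha.ne'] at this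
    exact this.mono_left nhdsWithin_le_nhds
  · filter_upwards [self_mem_nhdsWithin] with r hr
    exact Real.rpow_pos_of_pos hr _

lemma logCapacityRatio_le_of_hasCoverWithSum {δ : ℝ} (hδ : 0 < δ) (hδ1 : δ < 1) (hθ0 : 0 < θ)
    (hθ : θ ≤ 1) (hs : 0 ≤ s) (hsm : s ≤ m) (hne : F.Nonempty) (hF : Bornology.IsBounded F)
    (h : HasCoverWithSum θ δ s 1 F) : logCapacityRatio (δ ^ (1 / θ)) θ s m F ≤ s := by
  have hr : 0 < δ ^ (1 / θ) := by positivity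
  have hr1 : δ ^ (1 / θ) < 1 := Real.rpow_lt_one hδ.le hδ1 (by positivity)
  rw [logCapacityRatio_le_iff hr hr1 (minEnergy_pos hr hr1.le hθ hs hsm hne hF)]
  exact rpow_le_minEnergy_of_hasCoverWithSum hδ hδ1.le hθ0 hθ hs hsm hne h

/-- The number of dyadic scales between r and D is only logarithmic in 1/r. -/
lemma exists_pow_two_mul_ge {D r : ℝ} (hD : 1 ≤ D) (hr : 0 < r) (hr1 : r ≤ 1) :
    ∃ M : ℕ, D ≤ 2 ^ M * r ∧ (M : ℝ) + 1 ≤ (Real.log D - Real.log r) / Real.log 2 + 2 := by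
  have hD0 : 0 < D := by linarith
  have hnn : 0 ≤ Real.logb 2 (D / r) :=
    Real.logb_nonneg one_lt_two ((one_le_div hr).2 (hr1.trans hD))
  refine ⟨⌈Real.logb 2 (D / r)⌉₊, ?_, ?_⟩
  · rw [← div_le_iff₀ hr, ← Real.rpow_natCast, ← Real.logb_le_iff_le_rpow one_lt_two (by positivity)]
    exact Nat.le_ceil _
  · have := Nat.ceil_lt_add_one hnn
    rw [Real.logb, Real.log_div hD0.ne' hr.ne'] at this
    rw [Real.logb, Real.log_div hD0.ne' hr.ne']
    linarith

lemma eventually_hasCoverWithSum (hn : 1 ≤ n) (hθ0 : 0 < θ) (hθ : θ ≤ 1) (ht : 0 ≤ t) (htn : t ≤ n)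
    (hts : t < s) (hne : F.Nonempty) (hF : Bornology.IsBounded F) {ε : ℝ} (hε : 0 < ε) :
    ∀ᶠ r : ℝ in 𝓝[>] 0, logCapacityRatio r θ t n F < t + θ * (s - t) / 2 →
      HasCoverWithSum θ (r ^ θ) s ε F := by
  obtain ⟨D, hD, hFD⟩ := exists_one_le_forall_dist_le hF
  -- The gain r^(θ(s-t)) is r^(2η): one factor r^η pays for the energy being only r^(t+η), the other
  -- beats log(1/r).
  set η := θ * (s - t) / 2 with hη
  have hη0 : 0 < η := by have := sub_pos.2 hts; positivity
  have hlim : Tendsto (fun r : ℝ => 102 ^ n *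
      ((Real.log D / Real.log 2 + 2) * r ^ η - Real.log r * r ^ η / Real.log 2)) (𝓝[>] 0)
      (𝓝 0) := by
    have h1 := (tendsto_rpow_nhdsGT_zero hη0).mono_right nhdsWithin_le_nhds
    have h2 := tendsto_log_mul_rpow_nhdsGT_zero hη0
    simpa using ((h1.const_mul (Real.log D / Real.log 2 + 2)).sub
      (h2.div_const (Real.log 2))).const_mul ((102 : ℝ) ^ n)
  filter_upwards [eventually_mem_Ioo, hlim.eventually (ge_mem_nhds hε)] with r hr hrε hratio
  obtain ⟨M, hM, hM'⟩ := exists_pow_two_mul_ge hD hr.1 hr.2.le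
  obtain ⟨𝒰, hadm, hsum⟩ := hasCoverWithSum_of_minEnergy hn hr.1 hr.2.le hθ0 hθ ht htn hts.le hne
    hF fun x hx y hy => (hFD x (subset_closure hx) y (subset_closure hy)).trans hM
  refine ⟨𝒰, hadm, hsum.trans (ENNReal.ofReal_le_ofReal (le_trans ?_ hrε))⟩
  have hE := minEnergy_pos hr.1 hr.2.le hθ ht htn hne hF
  have hγ := (logCapacityRatio_le_iff hr.1 hr.2 hE).1 hratio.le
  have hr0 := hr.1
  have h3 : r ^ t / minEnergy r θ t n F ≤ r ^ (-η) := by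
    rw [div_le_iff₀ hE]
    calc r ^ t = r ^ (-η) * r ^ (t + η) := by rw [← Real.rpow_add hr0]; congr 1; ring
      _ ≤ _ := by gcongr
  have hM0 : 0 ≤ (Real.log D - Real.log r) / Real.log 2 + 2 := le_trans (by positivity) hM'
  calc _ ≤ r ^ (θ * (s - t)) *
        (102 ^ n * ((Real.log D - Real.log r) / Real.log 2 + 2) * r ^ (-η)) := by
        gcongr
    _ = 102 ^ n * ((Real.log D - Real.log r) / Real.log 2 + 2) *
          (r ^ (θ * (s - t)) * r ^ (-η)) := by ring
    _ = _ := by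
        rw [← Real.rpow_add hr0, show θ * (s - t) + -η = η by rw [hη]; ring]
        ring

lemma sInf_coe_image_eq {S : Set ℝ} {a : ℝ} (hlow : ∀ s ∈ S, a ≤ s) (hmem : ∀ s, a < s → s ∈ S) :
    sInf ((fun s : ℝ => (s : EReal)) '' S) = a := by
  refine le_antisymm (le_of_forall_gt_imp_ge_of_dense fun c hc => ?_) (le_sInf ?_)
  · obtain ⟨x, hax, hxc⟩ := EReal.lt_iff_exists_real_btwn.1 hc
    exact (sInf_le (Set.mem_image_of_mem _ (hmem x (EReal.coe_lt_coe_iff.1 hax)))).trans hxc.le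
  · rintro _ ⟨s, hs, rfl⟩
    exact EReal.coe_le_coe_iff.2 (hlow s hs)

theorem lowerProfile_unique_and_lowerDim_eq (hn : 1 ≤ n) (hne : F.Nonempty)
    (hF : Bornology.IsBounded F) (hθ0 : 0 < θ) (hθ : θ ≤ 1) :
    (∃! s : ℝ, SolvesLowerProfile θ (n : ℝ) F s) ∧
      lowerDim θ F = (lowerProfile θ (n : ℝ) F : EReal) := by
  obtain ⟨a, ha, huniq, hmin⟩ := exists_isFixed_and_unique (θ := θ) (N := n)
    (L := fun s => liminf (fun r : ℝ => (logCapacityRatio r θ s n F : EReal)) (𝓝[>] 0))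
    n.cast_nonneg hθ0
    (fun t s ht hts hs => liminf_le_liminf (eventually_logCapacityRatio_mono hθ ht hts hs hne hF))
    (fun t s ht hts hs => (liminf_le_liminf
      (eventually_logCapacityRatio_le_add hθ ht hts hs hne hF)).trans_eq (liminf_add_coe _ _))
    (le_liminf_of_le (by isBoundedDefault)
      (eventually_logCapacityRatio_nonneg hθ le_rfl n.cast_nonneg hne))
    ((liminf_le_limsup (f := 𝓝[>] (0 : ℝ))).trans (limsup_logCapacityRatio_le hθ n.cast_nonneg le_rfl hne hF))
  refine ⟨⟨a, ha, huniq⟩, ?_⟩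
  have hprof : lowerProfile θ (n : ℝ) F = a := huniq _ (Classical.epsilon_spec (p := SolvesLowerProfile θ n F) ⟨a, ha⟩)
  rw [hprof]
  refine sInf_coe_image_eq ?_ fun s has => ⟨ha.1.1.trans has.le, fun ε hε δ₀ hδ₀ => ?_⟩
  · rintro s ⟨hs, hcov⟩
    -- Exponents above n fall outside the range of the kernel estimates, but a ≤ n settles them at
    -- once.
    rcases le_total (n : ℝ) s with hns | hsn
    · exact ha.1.2.trans hns
    refine hmin s hs hsn (liminf_le_of_frequently_le ?_)
    refine (tendsto_rpow_nhdsGT_zero (one_div_pos.2 hθ0)).frequently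
      (p := fun r => (logCapacityRatio r θ s n F : EReal) ≤ s) ?_
    rw [(nhdsGT_basis (0 : ℝ)).frequently_iff]
    intro δ₀ hδ₀
    -- Halving turns δ ≤ δ₀ into the strict inequality of the open interval; the bound 1/2 ensures δ
    -- < 1.
    obtain ⟨δ, hδ, hδle, h⟩ := hcov 1 one_pos (min (δ₀ / 2) (1 / 2))
      (lt_min (half_pos hδ₀) (by norm_num))
    have h1 := hδle.trans (min_le_left _ _)
    have h2 := hδle.trans (min_le_right _ _)
    exact ⟨δ, ⟨hδ, by linarith⟩, EReal.coe_le_coe_iff.2 (logCapacityRatio_le_of_hasCoverWithSum hδ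
      (by linarith) hθ0 hθ hs hsn hne hF h)⟩
  · have hlt : liminf (fun r : ℝ => (logCapacityRatio r θ a n F : EReal)) (𝓝[>] 0) <
        ((a + θ * (s - a) / 2 : ℝ) : EReal) := by
      rw [show liminf (fun r : ℝ => (logCapacityRatio r θ a n F : EReal)) (𝓝[>] 0) = a from ha.2]
      have := mul_pos hθ0 (sub_pos.2 has)
      exact EReal.coe_lt_coe_iff.2 (by linarith)
    have hsmall : ∀ᶠ r : ℝ in 𝓝[>] 0, r ^ θ ∈ Set.Ioc 0 δ₀ :=
      (tendsto_rpow_nhdsGT_zero hθ0).eventually (Ioc_mem_nhdsGT hδ₀)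
    -- A lower limit below the threshold gives it only along some arbitrarily small r, which is all
    -- the lower dimension asks for.
    obtain ⟨r, hr, hr', hcov⟩ := ((frequently_lt_of_liminf_lt (by isBoundedDefault) hlt).and_eventually
      (hsmall.and (eventually_hasCoverWithSum hn hθ0 hθ ha.1.1 ha.1.2 has hne hF hε))).exists
    exact ⟨r ^ θ, hr'.1, hr'.2, hcov (EReal.coe_lt_coe_iff.1 hr)⟩

theorem upperProfile_unique_and_upperDim_eq (hn : 1 ≤ n) (hne : F.Nonempty)
    (hF : Bornology.IsBounded F) (hθ0 : 0 < θ) (hθ : θ ≤ 1) :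
    (∃! s : ℝ, SolvesUpperProfile θ (n : ℝ) F s) ∧
      upperDim θ F = (upperProfile θ (n : ℝ) F : EReal) := by
  obtain ⟨a, ha, huniq, hmin⟩ := exists_isFixed_and_unique (θ := θ) (N := n)
    (L := fun s => limsup (fun r : ℝ => (logCapacityRatio r θ s n F : EReal)) (𝓝[>] 0))
    n.cast_nonneg hθ0
    (fun t s ht hts hs => limsup_le_limsup (eventually_logCapacityRatio_mono hθ ht hts hs hne hF))
    (fun t s ht hts hs => (limsup_le_limsup
      (eventually_logCapacityRatio_le_add hθ ht hts hs hne hF)).trans_eq (limsup_add_coe _ _))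
    ((le_liminf_of_le (by isBoundedDefault)
      (eventually_logCapacityRatio_nonneg hθ le_rfl n.cast_nonneg hne)).trans (liminf_le_limsup (f := 𝓝[>] (0 : ℝ))))
    (limsup_logCapacityRatio_le hθ n.cast_nonneg le_rfl hne hF)
  refine ⟨⟨a, ha, huniq⟩, ?_⟩
  have hprof : upperProfile θ (n : ℝ) F = a := huniq _ (Classical.epsilon_spec (p := SolvesUpperProfile θ n F) ⟨a, ha⟩)
  rw [hprof]
  refine sInf_coe_image_eq ?_ fun s has => ⟨ha.1.1.trans has.le, fun ε hε => ?_⟩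
  · rintro s ⟨hs, hcov⟩
    rcases le_total (n : ℝ) s with hns | hsn
    · exact ha.1.2.trans hns
    refine hmin s hs hsn (limsup_le_of_le (by isBoundedDefault) ?_)
    obtain ⟨δ₀, hδ₀, hcov⟩ := hcov 1 one_pos
    filter_upwards [eventually_mem_Ioo,
      (tendsto_rpow_nhdsGT_zero hθ0).eventually (Ioc_mem_nhdsGT hδ₀)] with r hr hrδ
    have h := logCapacityRatio_le_of_hasCoverWithSum (m := n) hrδ.1
      (Real.rpow_lt_one hr.1.le hr.2 hθ0) hθ0 hθ hs hsn hne hF (hcov _ hrδ.1 hrδ.2)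
    rw [← Real.rpow_mul hr.1.le, mul_one_div_cancel hθ0.ne', Real.rpow_one] at h
    exact EReal.coe_le_coe_iff.2 h
  · have hlt : limsup (fun r : ℝ => (logCapacityRatio r θ a n F : EReal)) (𝓝[>] 0) <
        ((a + θ * (s - a) / 2 : ℝ) : EReal) := by
      rw [show limsup (fun r : ℝ => (logCapacityRatio r θ a n F : EReal)) (𝓝[>] 0) = a from ha.2]
      have := mul_pos hθ0 (sub_pos.2 has)
      exact EReal.coe_lt_coe_iff.2 (by linarith)
    -- Substituting r = δ^(1/θ) turns a statement for all small r into one for all small δ.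
    have hev := (tendsto_rpow_nhdsGT_zero (one_div_pos.2 hθ0)).eventually
      ((eventually_lt_of_limsup_lt hlt).and
        (eventually_hasCoverWithSum hn hθ0 hθ ha.1.1 ha.1.2 has hne hF hε))
    obtain ⟨δ₀, hδ₀, hsub⟩ := mem_nhdsGT_iff_exists_Ioc_subset.1 hev
    refine ⟨δ₀, hδ₀, fun δ hδ hδle => ?_⟩
    obtain ⟨h1, h2⟩ := hsub ⟨hδ, hδle⟩
    have h := h2 (EReal.coe_lt_coe_iff.1 h1)
    rwa [← Real.rpow_mul hδ.le, one_div_mul_cancel hθ0.ne', Real.rpow_one] at h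

end Limits

end IntermediateDim

end

theorem theorem6p1 (n : ℕ) (hn : 1 ≤ n) (F : Set (EuclideanSpace ℝ (Fin n)))
    (hne : F.Nonempty) (hF : Bornology.IsBounded F) (θ : ℝ) (hθ : θ ∈ Set.Ioc (0 : ℝ) 1) :
    ((∃! s : ℝ, IntermediateDim.SolvesLowerProfile θ (n : ℝ) F s) ∧
      IntermediateDim.lowerDim θ F = (IntermediateDim.lowerProfile θ (n : ℝ) F : EReal)) ∧
    ((∃! s : ℝ, IntermediateDim.SolvesUpperProfile θ (n : ℝ) F s) ∧
      IntermediateDim.upperDim θ F = (IntermediateDim.upperProfile θ (n : ℝ) F : EReal)) :=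
  ⟨IntermediateDim.lowerProfile_unique_and_lowerDim_eq hn hne hF hθ.1 hθ.2,
    IntermediateDim.upperProfile_unique_and_upperDim_eq hn hne hF hθ.1 hθ.2⟩
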